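/- Let $J$ be a bounded Jacobi operator on $\ell^2(\{0,1,2,\dots\})$, i.e. the operator with the symmetric tridiagonal matrix that has bounded real diagonal entries $\alpha_0,\alpha_1,\dots$ and bounded off-diagonal entries $\beta_0,\beta_1,\dots>0$ ($\beta_k$ in positions $(k,k+1)$ and $(k+1,k)$). Its orthonormal polynomials $P_0,P_1,\dots$ are given by $P_{-1}=0$, $P_0=1$, $sP_k(s)=\beta_{k-1}P_{k-1}(s)+\alpha_kP_k(s)+\beta_kP_{k+1}(s)$. Its spectral measure is the unique compactly supported probability measure $\mu$ on $\mathbb R$ with $\langle e_0,(J-\lambda)^{-1}e_0\rangle=\int (s-\lambda)^{-1}\,d\mu(s)$ for all $\lambda\in\mathbb C\setminus\sigma(J)$. Let $\Delta$ be the free Jacobi operator (all $\alpha_k=0$, all $\beta_k=\tfrac12$), let $U_0,U_1,\dots$ be its orthonormal polynomials (the Chebyshev polynomials of the second kind), and let $d\mu_\Delta(s)=\tfrac2\pi\sqrt{1-s^2}\,ds$ on $[-1,1]$ be its spectral measure. The connection coefficient matrix $C=C_{J\to\Delta}=(c_{ij})_{i,j\ge0}$ is the upper triangular matrix with $P_k=c_{0k}U_0+c_{1k}U_1+\dots+c_{kk}U_k$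 for all $k$. **Theorem 4.12.** Suppose that for some $n\ge1$ the operator $J$ equals $\Delta$ outside its $n\times n$ principal block, i.e. $\alpha_k=0$ and $\beta_{k-1}=\tfrac12$ for all $k\ge n$. Then $C=C_{\rm Toe}+C_{\rm fin}$, where $C_{\rm fin}$ has only finitely many nonzero entries and $C_{\rm Toe}$ is the upper triangular Toeplitz matrix $(t_{j-i})_{i,j\ge 0}$ with $t_k=0$ unless $0\le k\le 2n-1$; let $c(z)=\sum_{k=0}^{2n-1}t_kz^k$ be its symbol, and let $p_C(s)=\sum_{k=0}^{2n-1}c_{0k}P_k(s)$. Then: 1. The roots $z_1,\dots,z_r$ of $c$ in the open unit disc $\{z\in\mathbb C:|z|<1\}$ are all real and simple, and $r\le n$. 2. The only possible roots of $c$ on the unit circle are $\pm1$, and these can only be simple. 3. $p_C>0$ on $(-1,1)$, and with $\lambda(z)=\tfrac12(z+z^{-1})$ the spectral measure of $J$ is $$\mu=\frac1{p_C}\,\mu_\Delta+\sum_{k=1}^r w_k\,\delta_{\lambda(z_k)},\qquad w_k=\frac{(z_k-z_k^{-1})^2}{z_k\,c'(z_k)\,c(z_k^{-1})}>0 .$$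 -/

import Mathlib

open MeasureTheory Polynomial
open scoped ENNReal

/-- The Hilbert space `ℓ²({0,1,2,…})` over `ℂ`. -/
abbrev EllTwo : Type := lp (fun _ : ℕ => ℂ) 2

/-- The data of a bounded Jacobi operator: the real diagonal entries `α k`, the positive
off-diagonal entries `β k`, both bounded. -/
structure JacobiData where
  /-- the diagonal entries -/
  α : ℕ → ℝ
  /-- the off-diagonal entries: `β k` stands in positions `(k, k+1)` and `(k+1, k)` -/
  β : ℕ → ℝ
  β_pos : ∀ k, 0 < β k
  bounded : ∃ M : ℝ, ∀ k, |α k| ≤ M ∧ |β k| ≤ M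

namespace JacobiData

/-- The action of the tridiagonal matrix with rows
`(…, β (k-1), α k, β k, …)` on a sequence. -/
def act (J : JacobiData) (x : ℕ → ℂ) : ℕ → ℂ
  | 0 => (J.α 0 : ℂ) * x 0 + (J.β 0 : ℂ) * x 1
  | k + 1 => (J.β k : ℂ) * x k + (J.α (k + 1) : ℂ) * x (k + 1) + (J.β (k + 1) : ℂ) * x (k + 2)

theorem act_norm_sq_le (J : JacobiData) {M : ℝ} (hM : ∀ k, |J.α k| ≤ M ∧ |J.β k| ≤ M)
    (x : ℕ → ℂ) (k : ℕ) :
    ‖J.act x k‖ ^ 2 ≤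
      3 * M ^ 2 * (‖x (k - 1)‖ ^ 2 + ‖x k‖ ^ 2 + ‖x (k + 1)‖ ^ 2) := by
  have hM0 : 0 ≤ M := (abs_nonneg _).trans (hM 0).1
  have key : ∀ (a b c : ℝ) (u v w : ℂ), |a| ≤ M → |b| ≤ M → |c| ≤ M →
      ‖(a : ℂ) * u + (b : ℂ) * v + (c : ℂ) * w‖ ^ 2 ≤
        3 * M ^ 2 * (‖u‖ ^ 2 + ‖v‖ ^ 2 + ‖w‖ ^ 2) := by
    intro a b c u v w ha hb hc
    have h1 : ‖(a : ℂ) * u + (b : ℂ) * v + (c : ℂ) * w‖ ≤ M * (‖u‖ + ‖v‖ + ‖w‖) := by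
      refine (norm_add₃_le).trans ?_
      simp only [norm_mul, Complex.norm_real, Real.norm_eq_abs]
      have := mul_le_mul_of_nonneg_right ha (norm_nonneg u)
      have := mul_le_mul_of_nonneg_right hb (norm_nonneg v)
      have := mul_le_mul_of_nonneg_right hc (norm_nonneg w)
      linarith
    have h2 := pow_le_pow_left₀ (norm_nonneg _) h1 2
    have h3 : (‖u‖ + ‖v‖ + ‖w‖) ^ 2 ≤ 3 * (‖u‖ ^ 2 + ‖v‖ ^ 2 + ‖w‖ ^ 2) := by
      nlinarith [sq_nonneg (‖u‖ - ‖v‖), sq_nonneg (‖u‖ - ‖w‖), sq_nonneg (‖v‖ - ‖w‖)]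
    have h4 := mul_le_mul_of_nonneg_left h3 (sq_nonneg M)
    rw [mul_pow] at h2
    linarith
  cases k with
  | zero =>
    have := key 0 (J.α 0) (J.β 0) (x 0) (x 0) (x 1) (by simpa using hM0) (hM 0).1 (hM 0).2
    simpa [act] using this
  | succ k => exact key _ _ _ _ _ _ (hM k).2 (hM (k + 1)).1 (hM (k + 1)).2

theorem summable_aux {x : ℕ → ℂ} (hx : Summable fun k => ‖x k‖ ^ 2) :
    Summable (fun k => ‖x (k - 1)‖ ^ 2 + ‖x k‖ ^ 2 + ‖x (k + 1)‖ ^ 2) ∧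
    ∑' k, (‖x (k - 1)‖ ^ 2 + ‖x k‖ ^ 2 + ‖x (k + 1)‖ ^ 2) ≤ 4 * ∑' k, ‖x k‖ ^ 2 := by
  have h1 : Summable fun k => ‖x (k + 1)‖ ^ 2 := (summable_nat_add_iff 1).2 hx
  have h2 : Summable fun k => ‖x (k - 1)‖ ^ 2 := (summable_nat_add_iff 1).1 (by simpa using hx)
  refine ⟨(h2.add hx).add h1, ?_⟩
  rw [(h2.add hx).tsum_add h1, h2.tsum_add hx]
  have e1 := hx.tsum_eq_zero_add
  have e2 := h2.tsum_eq_zero_add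
  simp only [Nat.zero_sub, Nat.add_sub_cancel] at e2
  have p0 : ‖x 0‖ ^ 2 ≤ ∑' k, ‖x k‖ ^ 2 := hx.le_tsum 0 fun _ _ => sq_nonneg _
  have p1 : 0 ≤ ‖x 0‖ ^ 2 := sq_nonneg _
  linarith

theorem summable_sq (x : EllTwo) : Summable fun k => ‖x k‖ ^ 2 := by
  have := (memℓp_gen_iff (p := 2) (by norm_num)).1 (lp.memℓp x)
  simpa using this

theorem norm_sq_eq (x : EllTwo) : ‖x‖ ^ 2 = ∑' k, ‖x k‖ ^ 2 := by
  have := lp.norm_rpow_eq_tsum (p := 2) (by norm_num) x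
  simpa using this

theorem act_memlp (J : JacobiData) (x : EllTwo) : Memℓp (J.act x) 2 := by
  obtain ⟨M, hM⟩ := J.bounded
  refine memℓp_gen ?_
  have := Summable.of_nonneg_of_le (fun k => sq_nonneg ‖J.act x k‖) (J.act_norm_sq_le hM x)
    ((summable_aux (summable_sq x)).1.mul_left (3 * M ^ 2))
  simpa using this

/-- The Jacobi matrix as a linear map of `ℓ²`. -/
noncomputable def toLin (J : JacobiData) : EllTwo →ₗ[ℂ] EllTwo where
  toFun x := ⟨J.act x, J.act_memlp x⟩
  map_add' x y := by
    ext k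
    change J.act (⇑x + ⇑y) k = J.act x k + J.act y k
    cases k <;> simp [act] <;> ring
  map_smul' c x := by
    ext k
    cases k <;> simp [act] <;> ring

theorem toLin_bound (J : JacobiData) : ∃ K : ℝ, ∀ x, ‖J.toLin x‖ ≤ K * ‖x‖ := by
  obtain ⟨M, hM⟩ := J.bounded
  refine ⟨4 * |M|, fun x => ?_⟩
  refine le_of_sq_le_sq ?_ (by positivity)
  rw [norm_sq_eq, mul_pow, norm_sq_eq x]
  obtain ⟨s, hs⟩ := summable_aux (summable_sq x)
  have h0 : 0 ≤ ∑' k, ‖x k‖ ^ 2 := tsum_nonneg fun _ => sq_nonneg _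
  have h1 : ∑' k, ‖J.toLin x k‖ ^ 2 ≤
      ∑' k, 3 * M ^ 2 * (‖x (k - 1)‖ ^ 2 + ‖x k‖ ^ 2 + ‖x (k + 1)‖ ^ 2) :=
    (summable_sq (J.toLin x)).tsum_le_tsum (J.act_norm_sq_le hM x) (s.mul_left _)
  rw [tsum_mul_left] at h1
  have h2 := mul_le_mul_of_nonneg_left hs (by positivity : 0 ≤ 3 * M ^ 2)
  have h3 : 0 ≤ M ^ 2 * ∑' k, ‖x k‖ ^ 2 := by positivity
  rw [mul_pow, sq_abs]
  linarith

/-- The bounded Jacobi operator on `ℓ²` with the given entries. -/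
noncomputable def op (J : JacobiData) : EllTwo →L[ℂ] EllTwo :=
  J.toLin.mkContinuousOfExistsBound J.toLin_bound

/-- The vector `e₀ = (1, 0, 0, …)`. -/
noncomputable def e0 : EllTwo := lp.single 2 0 (1 : ℂ)

/-- The principal resolvent `G(λ) = ⟨e₀, (J - λ)⁻¹ e₀⟩`; meaningful for `λ ∉ σ(J)`. -/
noncomputable def principalResolvent (J : JacobiData) (l : ℂ) : ℂ :=
  inner ℂ e0 (Ring.inverse (J.op - l • (1 : EllTwo →L[ℂ] EllTwo)) e0)

/-- `μ` is a spectral measure of `J`: a compactly supported probability measure on `ℝ` with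
`G(λ) = ∫ (s - λ)⁻¹ dμ(s)` for all `λ ∈ ℂ ∖ σ(J)`. -/
structure IsSpectralMeasure (J : JacobiData) (μ : Measure ℝ) : Prop where
  prob : IsProbabilityMeasure μ
  compact_support : ∃ K : Set ℝ, IsCompact K ∧ μ Kᶜ = 0
  stieltjes : ∀ l : ℂ, l ∉ spectrum ℂ J.op →
    J.principalResolvent l = ∫ s : ℝ, ((s : ℂ) - l)⁻¹ ∂μ

/-- The orthonormal polynomials of `J`: `P 0 = 1`, `s P 0 = α 0 P 0 + β 0 P 1` and
`s P (k+1) = β k P k + α (k+1) P (k+1) + β (k+1) P (k+2)`. -/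
noncomputable def orthoPoly (J : JacobiData) : ℕ → ℝ[X]
  | 0 => 1
  | 1 => C (J.β 0)⁻¹ * (X - C (J.α 0))
  | k + 2 => C (J.β (k + 1))⁻¹ *
      ((X - C (J.α (k + 1))) * orthoPoly J (k + 1) - C (J.β k) * orthoPoly J k)

theorem degree_orthoPoly (J : JacobiData) (k : ℕ) : (J.orthoPoly k).degree = k := by
  induction k using Nat.twoStepInduction with
  | zero => simp [orthoPoly]
  | one =>
    rw [orthoPoly, degree_C_mul (inv_ne_zero (J.β_pos 0).ne'), degree_X_sub_C]
    rfl
  | more k h0 h1 =>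
    have e : ((X - C (J.α (k + 1))) * J.orthoPoly (k + 1)).degree = ((k + 2 : ℕ) : WithBot ℕ) := by
      rw [degree_mul, degree_X_sub_C, h1]
      norm_cast
      omega
    rw [orthoPoly, degree_C_mul (inv_ne_zero (J.β_pos (k + 1)).ne'),
      degree_sub_eq_left_of_degree_lt, e]
    rw [e, degree_C_mul (J.β_pos k).ne', h0]
    exact_mod_cast (by omega : k < k + 2)

/-- The orthonormal polynomials as a basis of `ℝ[X]`. -/
noncomputable def orthoBasis (J : JacobiData) : Module.Basis ℕ ℝ ℝ[X] :=
  (Polynomial.Sequence.mk J.orthoPoly J.degree_orthoPoly).basis fun i =>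
    (leadingCoeff_ne_zero.2 (Polynomial.Sequence.ne_zero _ i)).isUnit

/-- The connection coefficient matrix `C_{J→D} = (c_{ij})`: the entry `c_{ij}` is the
coefficient of `Q i` in the expansion `P j = c_{0j} Q 0 + c_{1j} Q 1 + …`, where `P` and `Q` are
the orthonormal polynomials of `J` and `D`. -/
noncomputable def connection (J D : JacobiData) (i j : ℕ) : ℝ :=
  D.orthoBasis.repr (J.orthoPoly j) i

/-- The free Jacobi operator `Δ`: zero diagonal and off-diagonal entries `1/2`. -/
noncomputable def free : JacobiData where
  α := fun _ => 0
  β := fun _ => 1 / 2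
  β_pos := fun _ => by norm_num
  bounded := ⟨1 / 2, fun _ => by norm_num [abs_of_pos]⟩

/-- `J` equals the free Jacobi operator outside its `n × n` principal block: `α k = 0` for
`k ≥ n`, and `β (k-1) = 1/2` for `k ≥ n`. -/
def EqFreeOutside (J : JacobiData) (n : ℕ) : Prop :=
  (∀ k, n ≤ k → J.α k = 0) ∧ ∀ k, n ≤ k + 1 → J.β k = 1 / 2

/-- The polynomial `p_C = ∑_{k=0}^{2n-1} c_{0,k} P k`, where `C = C_{J→Δ}`. -/
noncomputable def pC (J : JacobiData) (n : ℕ) : ℝ[X] :=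
  ∑ k ∈ Finset.range (2 * n), C (J.connection free 0 k) * J.orthoPoly k

end JacobiData

/-- The upper triangular Toeplitz matrix with symbol `c(z) = t₀ + t₁ z + t₂ z² + …`:
its `(i, j)` entry is `t_{j-i}`, and zero for `j < i`. -/
noncomputable def upperToeplitz (c : ℝ[X]) (i j : ℕ) : ℝ :=
  if i ≤ j then c.coeff (j - i) else 0

/-- `c` is the symbol of the Toeplitz part of the infinite matrix `A`: the matrix `A` is the
upper triangular Toeplitz matrix with symbol `c` plus a matrix with finitely many nonzero
entries. -/
def IsToeplitzSymbol (A : ℕ → ℕ → ℝ) (c : ℝ[X]) : Prop :=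
  {p : ℕ × ℕ | A p.1 p.2 - upperToeplitz c p.1 p.2 ≠ 0}.Finite

/-- The spectral measure of `Δ`: the semicircle law `(2/π) √(1 - s²) ds` on `[-1,1]`. -/
noncomputable def semicircle : Measure ℝ :=
  (volume.restrict (Set.Icc (-1) 1)).withDensity
    fun s => ENNReal.ofReal (2 / Real.pi * Real.sqrt (1 - s ^ 2))

/-- The Joukowski map. -/
noncomputable def joukowski (z : ℝ) : ℝ := (z + z⁻¹) / 2

/-- The weight `(z - z⁻¹)² / (z c'(z) c(z⁻¹))`. -/
noncomputable def diracWeight (c : ℝ[X]) (z : ℝ) : ℝ :=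
  (z - z⁻¹) ^ 2 / (z * (derivative c).eval z * c.eval z⁻¹)

/-!
Write `n = N + 1`. The argument rests on the Joukowski parametrisation `s = (z + z⁻¹) / 2`. The
polynomials `z ^ k P_k((z + z⁻¹) / 2)` (`firstLift`) satisfy a polynomial recurrence, which for
`k ≥ N` is that of the free operator. So the polynomial `c(z) = z ^ n (P_n - z P_{n-1})` (`jost`)
keeps the same value if `n` is replaced by a larger index, and
`(z⁻¹ - z) P_k = z ^ (-k-1) c(z) - z ^ (k+1) c(z⁻¹)` for `k ≥ N`. Comparing this with the formula
for the Chebyshev polynomials identifies the far columns of the connection coefficient matrix with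
those of the Toeplitz matrix of `c` (`connection_eq_upperToeplitz`). By `C J = Δ C` the vector of
the sums `∑ c_{ik} P_k` over the rows is `p_C` times that of the `U_i`, which gives
`p_C((z + z⁻¹) / 2) = c(z) c(z⁻¹)` (`aeval_pC`).

The statements on the roots come from Green's formula (`green`) for the first `n` rows of `J`. The
Wronskian excludes common zeros of consecutive lifts, hence zeros of `c` on the unit circle other
than `±1`, and multiple ones there because the Joukowski map is stationary at `±1`. Pairing `P`
with its complex conjugate shows that the roots in the disc are real, and the confluent
Christoffel–Darboux formula writes `x c'(x) c(x⁻¹)` at such a root as a positive sum of squares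
(`jost_weight_pos`), so that the root is simple and its weight is positive. The same sign says that
`p_C` crosses zero in one direction at all corresponding points of `(1, ∞)`, and likewise on
`(-∞, -1)`; so it has further zeros between them, and since its degree is at most `2n - 1`, there
are at most `n` roots (`card_jostRoots_le`).

For the spectral measure, let `z d` be the analogue of `c` for the polynomials of the second kind.
For `l = (z + z⁻¹) / 2` outside the spectrum, with `|z| ≤ 1`, a square summable solution `u` of
`(J - l) u = e₀` has no growing part, which forces `|z| < 1`, `c(z) ≠ 0` and
`G(l) = - z d(z) / c(z)` (`principalResolvent_eq`); neither self-adjointness nor the spectral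
theorem enters. Conversely the Wronskian relation between `c` and `d` (`jost_wronskian`) splits the
density into a function of `z` and the same function of `z⁻¹`, which turns the Stieltjes transform
of `p_C⁻¹ μ_Δ` into a contour integral of a meromorphic function whose poles in the disc, all
simple, are `z` and the roots of `c`. The residue at `z` is the resolvent and the others are
cancelled by the point masses (`integral_density`, `integral_jostMeasure`). A compactly supported
measure is determined by its Stieltjes transform near infinity
(`MeasureTheory.Measure.ext_of_stieltjes`), which gives uniqueness.
-/

namespace JacobiData

/-! ### The three-term recurrence -/

/-- The action of the tridiagonal matrix of `J` on sequences with values in a real algebra. -/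
def row {A : Type*} [CommRing A] [Algebra ℝ A] (J : JacobiData) (x : ℕ → A) : ℕ → A
  | 0 => J.α 0 • x 0 + J.β 0 • x 1
  | k + 1 => J.β k • x k + J.α (k + 1) • x (k + 1) + J.β (k + 1) • x (k + 2)

/-- Green's formula: summation by parts for the symmetric matrix of `J`. -/
theorem green {A : Type*} [CommRing A] [Algebra ℝ A] (J : JacobiData) (x y : ℕ → A) (M : ℕ) :
    ∑ k ∈ Finset.range (M + 1), (x k * J.row y k - J.row x k * y k) =
      J.β M • (x M * y (M + 1) - x (M + 1) * y M) := by
  induction M with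
  | zero => simp [row, Algebra.smul_def]; ring
  | succ M ih =>
    rw [Finset.sum_range_succ, ih]
    simp only [row, Algebra.smul_def]
    ring

theorem row_orthoPoly (J : JacobiData) (k : ℕ) :
    J.row J.orthoPoly k = X * J.orthoPoly k := by
  cases k with
  | zero =>
    have h : C (J.β 0) * C (J.β 0)⁻¹ = 1 := by
      rw [← C_mul, mul_inv_cancel₀ (J.β_pos 0).ne', C_1]
    simp only [row, orthoPoly, smul_eq_C_mul]
    linear_combination (X - C (J.α 0)) * h
  | succ k =>
    have h : C (J.β (k + 1)) * C (J.β (k + 1))⁻¹ = 1 := by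
      rw [← C_mul, mul_inv_cancel₀ (J.β_pos _).ne', C_1]
    simp only [row, orthoPoly, smul_eq_C_mul]
    linear_combination
      ((X - C (J.α (k + 1))) * J.orthoPoly (k + 1) - C (J.β k) * J.orthoPoly k) * h

theorem row_aeval {A : Type*} [CommRing A] [Algebra ℝ A] (J : JacobiData) (s : A) (k : ℕ) :
    J.row (fun k => aeval s (J.orthoPoly k)) k = s * aeval s (J.orthoPoly k) := by
  have h := congrArg (aeval s) (J.row_orthoPoly k)
  cases k <;> simpa [row] using h

/-- The solution of the three-term recurrence of `J` at the point `(z + z⁻¹) / 2`, with its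
`k`-th entry multiplied by `z ^ k` so that it becomes a polynomial in `z`; the first two
entries are prescribed. -/
noncomputable def lift (J : JacobiData) (q₀ q₁ : ℝ[X]) : ℕ → ℝ[X]
  | 0 => q₀
  | 1 => q₁
  | k + 2 => C (J.β (k + 1))⁻¹ *
      ((C (1 / 2) * (X ^ 2 + 1) - C (J.α (k + 1)) * X) * lift J q₀ q₁ (k + 1) -
        C (J.β k) * X ^ 2 * lift J q₀ q₁ k)

/-- The polynomials `z ^ k * P k ((z + z⁻¹) / 2)`. -/
noncomputable def firstLift (J : JacobiData) : ℕ → ℝ[X] :=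
  J.lift 1 (C (J.β 0)⁻¹ * (C (1 / 2) * (X ^ 2 + 1) - C (J.α 0) * X))

/-- The polynomials `z ^ (k - 1) * R k ((z + z⁻¹) / 2)`, where `R` are the polynomials of the
second kind: `R 0 = 0`, `R 1 = 1 / β 0`, and `R` satisfies the recurrence of `P`. -/
noncomputable def secondLift (J : JacobiData) : ℕ → ℝ[X] :=
  J.lift 0 (C (J.β 0)⁻¹)

/-- The Jost function of `J`. If `J` is free outside its principal block of size `N + 1`, this
is the symbol of the Toeplitz part of the connection coefficient matrix. -/
noncomputable def jost (J : JacobiData) (N : ℕ) : ℝ[X] :=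
  J.firstLift (N + 1) - X ^ 2 * J.firstLift N

/-- The analogue of the Jost function for the polynomials of the second kind, divided by `z`. -/
noncomputable def secondJost (J : JacobiData) (N : ℕ) : ℝ[X] :=
  J.secondLift (N + 1) - X ^ 2 * J.secondLift N

theorem lift_rec (J : JacobiData) (q₀ q₁ : ℝ[X]) (k : ℕ) :
    C (J.β (k + 1)) * J.lift q₀ q₁ (k + 2) =
      (C (1 / 2) * (X ^ 2 + 1) - C (J.α (k + 1)) * X) * J.lift q₀ q₁ (k + 1) -
        C (J.β k) * X ^ 2 * J.lift q₀ q₁ k := by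
  rw [lift, ← mul_assoc, ← C_mul, mul_inv_cancel₀ (J.β_pos _).ne', C_1, one_mul]

theorem lift_wronskian (J : JacobiData) (k : ℕ) :
    C (J.β k) * (J.firstLift k * J.secondLift (k + 1) - J.firstLift (k + 1) * J.secondLift k) =
      X ^ (2 * k) := by
  induction k with
  | zero =>
    simp only [firstLift, secondLift, lift, mul_zero, sub_zero, one_mul, pow_zero]
    rw [← C_mul, mul_inv_cancel₀ (J.β_pos _).ne', C_1]
  | succ k ih =>
    have h1 := J.lift_rec 1 (C (J.β 0)⁻¹ * (C (1 / 2) * (X ^ 2 + 1) - C (J.α 0) * X)) k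
    have h2 := J.lift_rec 0 (C (J.β 0)⁻¹) k
    change _ = _ * J.firstLift (k + 1) - _ * J.firstLift k at h1
    change _ = _ * J.secondLift (k + 1) - _ * J.secondLift k at h2
    change C (J.β (k + 1)) * J.firstLift (k + 2) = _ at h1
    change C (J.β (k + 1)) * J.secondLift (k + 2) = _ at h2
    linear_combination J.firstLift (k + 1) * h2 - J.secondLift (k + 1) * h1 + X ^ 2 * ih

/-- The lift is symmetric under `z ↦ z⁻¹` as soon as its initial data are; the factor `κ`
accounts for a common monomial factor of the initial data. -/
theorem lift_inv {K : Type*} [Field K] [Algebra ℝ K] (J : JacobiData)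
    (q₀ q₁ : ℝ[X]) {z : K} (κ : K) (hz : z ≠ 0) (h0 : aeval z⁻¹ q₀ = κ * aeval z q₀)
    (h1 : z ^ 2 * aeval z⁻¹ q₁ = κ * aeval z q₁) (k : ℕ) :
    z ^ (2 * k) * aeval z⁻¹ (J.lift q₀ q₁ k) = κ * aeval z (J.lift q₀ q₁ k) := by
  induction k using Nat.twoStepInduction with
  | zero => simpa [lift] using h0
  | one => simpa [lift] using h1
  | more k ih0 ih1 =>
    have e1 : z ^ 2 * (z⁻¹) ^ 2 = 1 := by field_simp
    have e2 : z ^ 2 * z⁻¹ = z := by field_simp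
    simp only [lift, map_mul, map_sub, aeval_C, map_add, map_pow, aeval_X, map_one]
    set b := algebraMap ℝ K (J.β (k + 1))⁻¹
    set a := algebraMap ℝ K (J.α (k + 1))
    set b' := algebraMap ℝ K (J.β k)
    set h := algebraMap ℝ K (1 / 2)
    linear_combination b * (h * (1 + z ^ 2) - a * z) * ih1 - b * b' * z ^ 2 * ih0
      + b * h * z ^ (2 * k) * z ^ 2 * aeval z⁻¹ (J.lift q₀ q₁ (k + 1)) * e1
      - b * a * z ^ (2 * k) * z ^ 2 * aeval z⁻¹ (J.lift q₀ q₁ (k + 1)) * e2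
      - b * b' * z ^ 2 * z ^ (2 * k) * aeval z⁻¹ (J.lift q₀ q₁ k) * e1

theorem firstLift_inv {K : Type*} [Field K] [Algebra ℝ K] (J : JacobiData) {z : K}
    (hz : z ≠ 0) (k : ℕ) :
    z ^ (2 * k) * aeval z⁻¹ (J.firstLift k) = aeval z (J.firstLift k) := by
  have := J.lift_inv 1 (C (J.β 0)⁻¹ * (C (1 / 2) * (X ^ 2 + 1) - C (J.α 0) * X)) 1 hz
    (by simp) (by
      simp only [map_mul, map_sub, aeval_C, map_add, map_pow, aeval_X, map_one]
      field_simp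
      ring) k
  simpa [firstLift] using this

theorem secondLift_inv {K : Type*} [Field K] [Algebra ℝ K] (J : JacobiData) {z : K}
    (hz : z ≠ 0) (k : ℕ) :
    z ^ (2 * k) * aeval z⁻¹ (J.secondLift k) = z ^ 2 * aeval z (J.secondLift k) :=
  J.lift_inv 0 (C (J.β 0)⁻¹) (z ^ 2) hz (by simp) (by simp) k

theorem firstLift_eq {K : Type*} [Field K] [Algebra ℝ K] [CharZero K] (J : JacobiData) {z : K}
    (hz : z ≠ 0) (k : ℕ) :
    aeval z (J.firstLift k) = z ^ k * aeval ((z + z⁻¹) / 2) (J.orthoPoly k) := by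
  have hh : algebraMap ℝ K (1 / 2) = 1 / 2 := by rw [map_div₀, map_one, map_ofNat]
  have e : z * ((z + z⁻¹) / 2) = 1 / 2 * (z ^ 2 + 1) := by field_simp
  unfold firstLift
  induction k using Nat.twoStepInduction with
  | zero => simp [lift, orthoPoly]
  | one =>
    simp only [lift, orthoPoly, map_mul, map_sub, aeval_C, map_add, map_pow, aeval_X, map_one, hh]
    linear_combination -algebraMap ℝ K (J.β 0)⁻¹ * e
  | more k ih0 ih1 =>
    simp only [lift, orthoPoly, map_mul, map_sub, aeval_C, map_add, map_pow, aeval_X, map_one,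
      hh, ih0, ih1]
    linear_combination -algebraMap ℝ K (J.β (k + 1))⁻¹ * z ^ (k + 1) *
      aeval ((z + z⁻¹) / 2) (J.orthoPoly (k + 1)) * e

/-- At `z = ±1` the derivative of the Joukowski map vanishes, so only the factor `z ^ k` of the
lift contributes to its derivative. -/
theorem derivative_firstLift_of_sq_eq_one (J : JacobiData) {z : ℝ} (hz : z ^ 2 = 1) (k : ℕ) :
    (derivative (J.firstLift k)).eval z = k * z * (J.firstLift k).eval z := by
  unfold firstLift
  induction k using Nat.twoStepInduction with
  | zero => simp [lift]
  | one =>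
    simp [lift]
    linear_combination (J.β 0)⁻¹ * (J.α 0 - z / 2) * hz
  | more k ih0 ih1 =>
    simp only [lift, derivative_mul, derivative_sub, derivative_add, derivative_C,
      derivative_X_pow, derivative_X, derivative_one, eval_mul, eval_sub, eval_add, eval_C,
      eval_X, eval_pow, eval_one, eval_zero, ih0, ih1]
    set u := eval z (J.lift 1 (C (J.β 0)⁻¹ * (C (1 / 2) * (X ^ 2 + 1) - C (J.α 0) * X)) (k + 1))
    set v := eval z (J.lift 1 (C (J.β 0)⁻¹ * (C (1 / 2) * (X ^ 2 + 1) - C (J.α 0) * X)) k)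
    push_cast
    norm_num
    linear_combination (J.β (k + 1))⁻¹ * (u * (J.α (k + 1) - z / 2) + 2 * z * J.β k * v) * hz

theorem natDegree_firstLift_le (J : JacobiData) (k : ℕ) : (J.firstLift k).natDegree ≤ 2 * k := by
  have hq : ∀ a : ℝ, (C (1 / 2) * (X ^ 2 + 1) - C a * X : ℝ[X]).natDegree ≤ 2 := by
    intro a
    compute_degree
  unfold firstLift
  induction k using Nat.twoStepInduction with
  | zero => simp [lift]
  | one =>
    rw [lift]
    exact (natDegree_C_mul_le _ _).trans (hq _)
  | more k ih0 ih1 =>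
    rw [lift]
    refine (natDegree_C_mul_le _ _).trans
      ((natDegree_sub_le _ _).trans (max_le ?_ ?_))
    · exact (natDegree_mul_le_of_le (hq _) ih1).trans (by omega)
    · have : (C (J.β k) * X ^ 2 : ℝ[X]).natDegree ≤ 2 := by compute_degree
      exact (natDegree_mul_le_of_le this ih0).trans (by omega)

theorem eval_zero_firstLift_succ (J : JacobiData) (k : ℕ) :
    (J.firstLift (k + 1)).eval 0 = (2 * J.β k)⁻¹ * (J.firstLift k).eval 0 := by
  cases k with
  | zero => simp [firstLift, lift]
  | succ k =>
    simp [firstLift, lift]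
    ring

theorem eval_zero_firstLift_pos (J : JacobiData) (k : ℕ) : 0 < (J.firstLift k).eval 0 := by
  induction k with
  | zero => simp [firstLift, lift]
  | succ k ih =>
    have := J.β_pos k
    rw [eval_zero_firstLift_succ]
    positivity

theorem eval_zero_secondLift (J : JacobiData) (k : ℕ) :
    (J.secondLift (k + 1)).eval 0 = 2 * (J.firstLift (k + 1)).eval 0 := by
  induction k with
  | zero =>
    simp [firstLift, secondLift, lift]
    ring
  | succ k ih =>
    rw [eval_zero_firstLift_succ, mul_left_comm, ← ih]
    simp [secondLift, lift]
    ring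

theorem coeff_firstLift_succ (J : JacobiData) (k : ℕ) :
    (J.firstLift (k + 1)).coeff (2 * (k + 1)) =
      (2 * J.β k)⁻¹ * (J.firstLift k).coeff (2 * k) := by
  cases k with
  | zero =>
    simp [firstLift, lift, coeff_one]
  | succ k =>
    have h1 := J.natDegree_firstLift_le (k + 1)
    have h0 := J.natDegree_firstLift_le k
    have e : J.firstLift (k + 1 + 1) = C (J.β (k + 1))⁻¹ *
      (C (1 / 2) * (J.firstLift (k + 1) * X ^ 2) + C (1 / 2) * J.firstLift (k + 1)
        - C (J.α (k + 1)) * (J.firstLift (k + 1) * X) - C (J.β k) * (J.firstLift k * X ^ 2)) := by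
      simp only [firstLift, lift]
      ring
    rw [e]
    have e2 : 2 * (k + 1 + 1) = 2 * (k + 1) + 2 := by ring
    have e3 : (J.firstLift (k + 1) * X).coeff (2 * (k + 1) + 2) = 0 := by
      rw [coeff_mul_X]
      exact coeff_eq_zero_of_natDegree_lt (by omega)
    rw [e2, coeff_C_mul, coeff_sub, coeff_sub, coeff_add, coeff_C_mul, coeff_C_mul, coeff_C_mul,
      coeff_C_mul, e3, coeff_mul_X_pow, coeff_mul_X_pow,
      coeff_eq_zero_of_natDegree_lt (p := J.firstLift (k + 1)) (n := 2 * (k + 1) + 2) (by omega),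
      coeff_eq_zero_of_natDegree_lt (p := J.firstLift k) (by omega)]
    simp
    ring

/-! ### The Jost function -/

theorem lift_tail (J : JacobiData) {N : ℕ} (hJ : J.EqFreeOutside (N + 1)) (q₀ q₁ : ℝ[X])
    {k : ℕ} (hk : N ≤ k) :
    J.lift q₀ q₁ (k + 2) = (X ^ 2 + 1) * J.lift q₀ q₁ (k + 1) - X ^ 2 * J.lift q₀ q₁ k := by
  have h : (C (1 / 2) : ℝ[X]) * C 2 = 1 := by rw [← C_mul]; norm_num
  rw [lift, hJ.1 _ (by omega), hJ.2 _ (by omega), hJ.2 _ (by omega), one_div, inv_inv, ← one_div,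
    C_0]
  linear_combination ((X ^ 2 + 1) * J.lift q₀ q₁ (k + 1) - X ^ 2 * J.lift q₀ q₁ k) * h

theorem lift_jost (J : JacobiData) {N : ℕ} (hJ : J.EqFreeOutside (N + 1)) (q₀ q₁ : ℝ[X])
    {k : ℕ} (hk : N ≤ k) :
    J.lift q₀ q₁ (k + 1) - X ^ 2 * J.lift q₀ q₁ k =
      J.lift q₀ q₁ (N + 1) - X ^ 2 * J.lift q₀ q₁ N := by
  induction k, hk using Nat.le_induction with
  | base => rfl
  | succ k hk ih =>
    rw [← ih, J.lift_tail hJ _ _ hk]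
    ring

theorem firstLift_jost (J : JacobiData) {N : ℕ} (hJ : J.EqFreeOutside (N + 1))
    {k : ℕ} (hk : N ≤ k) : J.firstLift (k + 1) - X ^ 2 * J.firstLift k = J.jost N :=
  J.lift_jost hJ _ _ hk

theorem secondLift_jost (J : JacobiData) {N : ℕ} (hJ : J.EqFreeOutside (N + 1))
    {k : ℕ} (hk : N ≤ k) : J.secondLift (k + 1) - X ^ 2 * J.secondLift k = J.secondJost N :=
  J.lift_jost hJ _ _ hk

/-- Together with `firstLift_jost` this gives `firstLift k`, for `k ≥ N`, as a combination of the
two solutions of the free recurrence. -/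
theorem firstLift_diff (J : JacobiData) {N : ℕ} (hJ : J.EqFreeOutside (N + 1)) (j : ℕ) :
    J.firstLift (N + j + 1) - J.firstLift (N + j) =
      X ^ (2 * j) * (J.firstLift (N + 1) - J.firstLift N) := by
  induction j with
  | zero => simp
  | succ j ih =>
    have h : J.firstLift (N + j + 2) =
        (X ^ 2 + 1) * J.firstLift (N + j + 1) - X ^ 2 * J.firstLift (N + j) :=
      J.lift_tail hJ _ _ (by omega)
    rw [show N + (j + 1) + 1 = N + j + 2 by ring, show N + (j + 1) = N + j + 1 by ring, h]
    linear_combination X ^ 2 * ih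

theorem jost_inv {K : Type*} [Field K] [Algebra ℝ K] (J : JacobiData) {z : K}
    (hz : z ≠ 0) (N : ℕ) : z ^ (2 * N + 2) * aeval z⁻¹ (J.jost N) =
      aeval z (J.firstLift (N + 1)) - aeval z (J.firstLift N) := by
  rw [← J.firstLift_inv hz, ← J.firstLift_inv hz]
  simp only [jost, map_sub, map_mul, map_pow, aeval_X]
  field_simp
  ring

theorem secondJost_inv {K : Type*} [Field K] [Algebra ℝ K] (J : JacobiData) {z : K}
    (hz : z ≠ 0) (N : ℕ) : z ^ (2 * N + 2) * aeval z⁻¹ (J.secondJost N) =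
      z ^ 2 * (aeval z (J.secondLift (N + 1)) - aeval z (J.secondLift N)) := by
  rw [mul_sub, ← J.secondLift_inv hz, ← J.secondLift_inv hz]
  simp only [secondJost, map_sub, map_mul, map_pow, aeval_X]
  field_simp
  ring

theorem wronskian_aeval {K : Type*} [Field K] [Algebra ℝ K] (J : JacobiData) {N : ℕ}
    (hJ : J.EqFreeOutside (N + 1)) (z : K) :
    aeval z (J.firstLift N) * aeval z (J.secondLift (N + 1)) -
      aeval z (J.firstLift (N + 1)) * aeval z (J.secondLift N) = 2 * z ^ (2 * N) := by
  have h := congrArg (aeval z) (J.lift_wronskian N)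
  rw [hJ.2 N (by omega)] at h
  have e : (2 : K) * algebraMap ℝ K (1 / 2) = 1 := by
    rw [← map_ofNat (algebraMap ℝ K), ← map_mul]
    norm_num
  simp only [map_sub, map_mul, map_pow, aeval_X, aeval_C] at h
  linear_combination 2 * h - (aeval z (J.firstLift N) * aeval z (J.secondLift (N + 1)) -
      aeval z (J.firstLift (N + 1)) * aeval z (J.secondLift N)) * e

theorem jost_wronskian {K : Type*} [Field K] [Algebra ℝ K] (J : JacobiData) {N : ℕ}
    (hJ : J.EqFreeOutside (N + 1)) {z : K} (hz : z ≠ 0) :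
    aeval z (J.jost N) * (z⁻¹ * aeval z⁻¹ (J.secondJost N)) -
      z * aeval z (J.secondJost N) * aeval z⁻¹ (J.jost N) = 2 * (z⁻¹ - z) := by
  have h1 := J.jost_inv hz N
  have h2 := J.secondJost_inv hz N
  have h3 := J.wronskian_aeval hJ z
  refine mul_left_cancel₀ (pow_ne_zero (2 * N + 2) hz) ?_
  have e1 : aeval z (J.jost N) =
    aeval z (J.firstLift (N + 1)) - z ^ 2 * aeval z (J.firstLift N) := by simp [jost]
  have e2 : aeval z (J.secondJost N) =
    aeval z (J.secondLift (N + 1)) - z ^ 2 * aeval z (J.secondLift N) := by simp [secondJost]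
  have e3 : z * z⁻¹ = 1 := mul_inv_cancel₀ hz
  generalize aeval z (J.firstLift (N + 1)) = A at *
  generalize aeval z (J.firstLift N) = B at *
  generalize aeval z (J.secondLift (N + 1)) = E at *
  generalize aeval z (J.secondLift N) = F at *
  rw [e1, e2]
  linear_combination (A - z ^ 2 * B) * z⁻¹ * h2 - z * (E - z ^ 2 * F) * h1
    + z * (1 - z ^ 2) * h3 + (A - z ^ 2 * B) * z * (E - F) * e3 - 2 * z ^ (2 * N) * z * e3

end JacobiData

/-- Every complex number is a value of the Joukowski map on the punctured closed unit disc. -/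
theorem exists_joukowski_eq (s : ℂ) : ∃ z : ℂ, z ≠ 0 ∧ ‖z‖ ≤ 1 ∧ (z + z⁻¹) / 2 = s := by
  obtain ⟨w, hw⟩ := IsAlgClosed.exists_pow_nat_eq (s ^ 2 - 1) (n := 2) (by norm_num)
  have h : (s + w) * (s - w) = 1 := by linear_combination -hw
  have h0 : s + w ≠ 0 := left_ne_zero_of_mul_eq_one h
  have hi : (s + w)⁻¹ = s - w := inv_eq_of_mul_eq_one_right h
  rcases le_total ‖s + w‖ 1 with h1 | h1
  · exact ⟨s + w, h0, h1, by rw [hi]; ring⟩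
  · refine ⟨(s + w)⁻¹, inv_ne_zero h0, ?_, by rw [inv_inv, hi]; ring⟩
    rw [norm_inv]
    exact inv_le_one_of_one_le₀ h1

namespace JacobiData

theorem free_eqFreeOutside (n : ℕ) : free.EqFreeOutside n :=
  ⟨fun _ _ => rfl, fun _ _ => rfl⟩

/-! ### The connection coefficient matrix -/

theorem orthoBasis_apply (D : JacobiData) (i : ℕ) : D.orthoBasis i = D.orthoPoly i :=
  Polynomial.Sequence.basis_eq_self _ _ i

theorem repr_orthoPoly (D : JacobiData) (i : ℕ) :
    D.orthoBasis.repr (D.orthoPoly i) = Finsupp.single i 1 := by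
  rw [← orthoBasis_apply, Module.Basis.repr_self]

/-- Multiplication by `X` acts on the coefficients of a polynomial by the matrix of `D`, which
is symmetric. -/
theorem repr_X_mul (D : JacobiData) (p : ℝ[X]) (i : ℕ) :
    D.orthoBasis.repr (X * p) i = D.row (fun k => D.orthoBasis.repr p k) i := by
  let c : ℕ → ℝ[X] →ₗ[ℝ] ℝ := fun k => Finsupp.lapply k ∘ₗ D.orthoBasis.repr.toLinearMap
  let g : ℝ[X] →ₗ[ℝ] ℝ := match i with
    | 0 => D.α 0 • c 0 + D.β 0 • c 1
    | k + 1 => D.β k • c k + D.α (k + 1) • c (k + 1) + D.β (k + 1) • c (k + 2)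
  have h : c i ∘ₗ LinearMap.mulLeft ℝ (X : ℝ[X]) = g := by
    refine D.orthoBasis.ext fun j => ?_
    have e : D.orthoBasis.repr (X * D.orthoPoly j) i =
        D.row (fun k => (Finsupp.single k 1 : ℕ →₀ ℝ) i) j := by
      rw [← row_orthoPoly]
      cases j <;> simp [row, repr_orthoPoly, Finsupp.single_apply]
    rw [orthoBasis_apply]
    change D.orthoBasis.repr (X * D.orthoPoly j) i = _
    rw [e]
    cases i <;> cases j <;>
      simp [g, c, row, repr_orthoPoly, Finsupp.single_apply] <;> grind
  have h2 := LinearMap.congr_fun h p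
  change D.orthoBasis.repr (X * p) i = _ at h2
  rw [h2]
  cases i <;> rfl

/-- The connection coefficient matrix intertwines the two Jacobi matrices: `C J = D C`. -/
theorem row_connection (J D : JacobiData) (i j : ℕ) :
    J.row (fun k => J.connection D i k) j = D.row (fun k => J.connection D k j) i := by
  unfold connection
  rw [← repr_X_mul, ← row_orthoPoly]
  cases j <;> simp [row]

theorem free_firstLift_succ (k : ℕ) :
    free.firstLift (k + 1) = X ^ 2 * free.firstLift k + 1 := by
  have h := free.firstLift_jost (free_eqFreeOutside 1) (Nat.zero_le k)
  have h0 : free.jost 0 = 1 := by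
    have e : (C 2 : ℝ[X]) * C 2⁻¹ = 1 := by rw [← C_mul]; norm_num
    simp [jost, firstLift, lift, free]
    linear_combination (X ^ 2 + 1) * e
  rw [h0] at h
  linear_combination h

theorem one_sub_sq_mul_free_firstLift (k : ℕ) :
    (1 - X ^ 2) * free.firstLift k = 1 - X ^ (2 * k + 2) := by
  induction k with
  | zero => simp [firstLift, lift]
  | succ k ih =>
    rw [free_firstLift_succ]
    linear_combination X ^ 2 * ih

theorem one_sub_sq_mul_firstLift {K : Type*} [Field K] [Algebra ℝ K] (J : JacobiData) {N : ℕ}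
    (hJ : J.EqFreeOutside (N + 1)) {z : K} (hz : z ≠ 0) {k : ℕ} (hk : N ≤ k) :
    (1 - z ^ 2) * aeval z (J.firstLift k) =
      aeval z (J.jost N) - z ^ (2 * k + 2) * aeval z⁻¹ (J.jost N) := by
  obtain ⟨j, rfl⟩ := Nat.exists_eq_add_of_le hk
  have h1 := congrArg (aeval z) (J.firstLift_jost hJ hk)
  have h2 := congrArg (aeval z) (J.firstLift_diff hJ j)
  have h3 := J.jost_inv hz N
  simp only [map_sub, map_mul, map_pow, aeval_X] at h1 h2
  linear_combination h1 - h2 + z ^ (2 * j) * h3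

theorem natDegree_jost_le (J : JacobiData) {N : ℕ} (hJ : J.EqFreeOutside (N + 1)) :
    (J.jost N).natDegree ≤ 2 * N + 1 := by
  have h1 := J.natDegree_firstLift_le N
  have h2 := J.natDegree_firstLift_le (N + 1)
  rw [natDegree_le_iff_coeff_eq_zero]
  intro m hm
  rw [jost, coeff_sub, mul_comm]
  rcases Nat.lt_or_ge (2 * (N + 1)) m with h | h
  · obtain ⟨k, rfl⟩ : ∃ k, m = k + 2 := ⟨m - 2, by omega⟩
    rw [coeff_mul_X_pow, coeff_eq_zero_of_natDegree_lt (by omega),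
      coeff_eq_zero_of_natDegree_lt (by omega), sub_zero]
  · obtain rfl : m = 2 * (N + 1) := by omega
    rw [coeff_firstLift_succ, hJ.2 N (by omega), mul_add, coeff_mul_X_pow]
    norm_num

theorem eval_zero_jost_pos (J : JacobiData) (N : ℕ) : 0 < (J.jost N).eval 0 := by
  simpa [jost] using J.eval_zero_firstLift_pos (N + 1)

theorem eval_zero_secondJost (J : JacobiData) (N : ℕ) :
    (J.secondJost N).eval 0 = 2 * (J.jost N).eval 0 := by
  simpa [jost, secondJost] using J.eval_zero_secondLift N

/-- Far to the right, the columns of the connection coefficient matrix are those of the Toeplitz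
matrix whose symbol is the Jost function. -/
theorem orthoPoly_eq_sum (J : JacobiData) {N : ℕ} (hJ : J.EqFreeOutside (N + 1)) {j : ℕ}
    (hj : 2 * N + 1 ≤ j) : J.orthoPoly j =
      ∑ i ∈ Finset.range (j + 1), (J.jost N).coeff (j - i) • free.orthoPoly i := by
  -- compare values at the points `s = (z + z⁻¹) / 2` with `z > 1`
  refine Polynomial.eq_of_infinite_eval_eq _ _ ((Set.Ioi_infinite (1 : ℝ)).mono fun s hs => ?_)
  have hs : 1 < s := hs
  have hq : Real.sqrt (s ^ 2 - 1) ^ 2 = s ^ 2 - 1 := Real.sq_sqrt (by nlinarith)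
  have hq0 := Real.sqrt_nonneg (s ^ 2 - 1)
  obtain ⟨z, hz⟩ : ∃ z, z = s + Real.sqrt (s ^ 2 - 1) := ⟨_, rfl⟩
  have hz1 : 1 < z := by linarith
  have hz0 : z ≠ 0 := by positivity
  have hzi : z⁻¹ = s - Real.sqrt (s ^ 2 - 1) :=
    inv_eq_of_mul_eq_one_right (by rw [hz]; linear_combination -hq)
  have hl : (z + z⁻¹) / 2 = s := by rw [hzi, hz]; ring
  have hz2 : (1 - z ^ 2) ≠ 0 := by nlinarith
  have hd : (J.jost N).natDegree < j + 1 := by have := J.natDegree_jost_le hJ; omega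
  change eval s _ = eval s _
  refine mul_left_cancel₀ (pow_ne_zero j hz0) (mul_left_cancel₀ hz2 ?_)
  have e1 := J.one_sub_sq_mul_firstLift hJ hz0 (k := j) (by omega)
  rw [J.firstLift_eq hz0, hl, aeval_eq_sum_range' hd, aeval_eq_sum_range' hd,
    coe_aeval_eq_eval] at e1
  rw [e1, eval_finsetSum]
  conv_rhs => rw [← Finset.sum_flip]
  rw [Finset.mul_sum, Finset.mul_sum, Finset.mul_sum,
    ← Finset.sum_sub_distrib]
  refine Finset.sum_congr rfl fun m hm => ?_
  have hm : m ≤ j := by simpa [Nat.lt_succ_iff] using hm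
  have e2 := congrArg (aeval z) (one_sub_sq_mul_free_firstLift (j - m))
  rw [map_mul, free.firstLift_eq hz0, hl] at e2
  simp only [coe_aeval_eq_eval, eval_sub, eval_one, eval_X, eval_pow, eval_smul, smul_eq_mul,
    Nat.sub_sub_self hm] at e2 ⊢
  obtain ⟨l, rfl⟩ := Nat.exists_eq_add_of_le hm
  rw [Nat.add_sub_cancel_left] at e2 ⊢
  have e3 : z ^ m * z⁻¹ ^ m = 1 := by rw [← mul_pow, mul_inv_cancel₀ hz0, one_pow]
  linear_combination -(J.jost N).coeff m * z ^ m * e2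
    - (J.jost N).coeff m * z ^ (2 * l + m + 2) * e3

theorem connection_eq_upperToeplitz (J : JacobiData) {N : ℕ} (hJ : J.EqFreeOutside (N + 1))
    {j : ℕ} (hj : 2 * N + 1 ≤ j) (i : ℕ) :
    J.connection free i j = upperToeplitz (J.jost N) i j := by
  rw [connection, J.orthoPoly_eq_sum hJ hj, upperToeplitz, map_sum]
  simp [repr_orthoPoly, Finsupp.single_apply]

theorem connection_eq_zero (J D : JacobiData) {i j : ℕ} (h : j < i) : J.connection D i j = 0 := by
  have hm : J.orthoPoly j ∈ Submodule.span ℝ (D.orthoBasis '' Set.Iic j) := by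
    have := (Polynomial.Sequence.mk D.orthoPoly D.degree_orthoPoly).span_degreeLE (m := j)
      fun i _ => (leadingCoeff_ne_zero.2 (Polynomial.Sequence.ne_zero _ i)).isUnit
    have e : D.orthoBasis '' Set.Iic j = D.orthoPoly '' Set.Iic j :=
      Set.image_congr fun i _ => D.orthoBasis_apply i
    rw [e]
    erw [this]
    rw [mem_degreeLE, degree_orthoPoly]
  have := (D.orthoBasis.mem_span_image.1 hm)
  by_contra h'
  exact absurd (this (Finsupp.mem_support_iff.2 h')) (by simpa using h)

theorem isToeplitzSymbol_jost (J : JacobiData) {N : ℕ} (hJ : J.EqFreeOutside (N + 1)) :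
    IsToeplitzSymbol (J.connection free) (J.jost N) := by
  refine ((Set.finite_Iio (2 * N + 1)).prod (Set.finite_Iio (2 * N + 1))).subset ?_
  rintro ⟨i, j⟩ h
  rw [Set.mem_ofPred_eq] at h
  have hj : j < 2 * N + 1 := by
    by_contra hj
    exact h (by rw [J.connection_eq_upperToeplitz hJ (by omega), sub_self])
  refine ⟨?_, hj⟩
  by_contra hi
  simp only [Set.mem_Iio, not_lt] at hi
  exact h (by rw [J.connection_eq_zero _ (by omega), upperToeplitz, if_neg (by omega), sub_zero])

end JacobiData

theorem IsToeplitzSymbol.unique {A : ℕ → ℕ → ℝ} {c d : ℝ[X]} (hc : IsToeplitzSymbol A c)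
    (hd : IsToeplitzSymbol A d) : c = d := by
  ext m
  have hf := (hc.union hd).preimage (f := fun i => ((i, i + m) : ℕ × ℕ))
    (fun i _ j _ h => by simpa using congrArg Prod.fst h)
  obtain ⟨i, hi⟩ := hf.infinite_compl.nonempty
  have h : A i (i + m) - upperToeplitz c i (i + m) = 0 ∧
      A i (i + m) - upperToeplitz d i (i + m) = 0 := by
    simpa [not_or] using hi
  simp only [upperToeplitz, Nat.le_add_right, if_true, Nat.add_sub_cancel_left] at h
  linarith

namespace JacobiData

/-! ### The polynomial `p_C` -/

/-- The partial sums of the `i`-th row of the connection coefficient matrix against the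
orthonormal polynomials. Since `C J = Δ C`, they satisfy the recurrence of `Δ` in `i`, hence are
multiples of the first one. -/
theorem sum_connection_mul (J : JacobiData) {N : ℕ} (hJ : J.EqFreeOutside (N + 1)) {M : ℕ}
    (i : ℕ) (hi : i + 2 * N + 1 ≤ M) :
    ∑ k ∈ Finset.range (M + 1), J.connection free i k • J.orthoPoly k =
      free.orthoPoly i * J.pC (N + 1) := by
  have hz : ∀ i k, i + 2 * N + 2 ≤ k → J.connection free i k = 0 := by
    intro i k h
    rw [J.connection_eq_upperToeplitz hJ (by omega), upperToeplitz, if_pos (by omega)]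
    have := J.natDegree_jost_le hJ
    exact coeff_eq_zero_of_natDegree_lt (by omega)
  set v : ℕ → ℝ[X] := fun i =>
    ∑ k ∈ Finset.range (M + 1), J.connection free i k • J.orthoPoly k with hv
  have hX : ∀ i, i + 2 * N + 2 ≤ M → X * v i = free.row v i := by
    intro i hi
    have h := J.green (fun k => C (J.connection free i k)) J.orthoPoly M
    simp only [hz i M hi, hz i (M + 1) (by omega), C_0, zero_mul, sub_zero, smul_zero,
      Finset.sum_sub_distrib, sub_eq_zero, row_orthoPoly] at h
    have e : ∀ k, J.row (fun k => C (J.connection free i k)) k =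
        C (free.row (fun m => J.connection free m k) i) := by
      intro k
      rw [← row_connection]
      cases k <;> simp [row, smul_eq_C_mul]
    have e2 : X * v i = ∑ k ∈ Finset.range (M + 1),
        C (J.connection free i k) * (X * J.orthoPoly k) := by
      rw [hv, Finset.mul_sum]
      refine Finset.sum_congr rfl fun k _ => ?_
      rw [smul_eq_C_mul]
      ring
    rw [e2, h]
    simp only [e]
    cases i <;> simp [row, hv, smul_eq_C_mul, add_mul, Finset.sum_add_distrib, Finset.mul_sum,
      mul_assoc]
  have h2 : (C (1 / 2) : ℝ[X]) * C (1 / 2)⁻¹ = 1 := by rw [← C_mul]; norm_num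
  have h0 : v 0 = J.pC (N + 1) := by
    rw [pC, hv]
    simp only [smul_eq_C_mul]
    refine (Finset.sum_subset (fun k hk => ?_) fun k hk hk' => ?_).symm
    · simp only [Finset.mem_range] at hk ⊢
      omega
    · simp only [Finset.mem_range, not_lt] at hk'
      rw [hz 0 k (by omega), C_0, zero_mul]
  have key : ∀ i, i + 2 * N + 1 ≤ M → v i = free.orthoPoly i * v 0 := by
    intro i
    induction i using Nat.twoStepInduction with
    | zero => simp [orthoPoly]
    | one =>
      intro hi
      have := hX 0 (by omega)
      simp only [row, free, zero_smul, zero_add, smul_eq_C_mul] at this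
      simp only [orthoPoly, free, C_0]
      linear_combination -C (1 / 2)⁻¹ * this - v 1 * h2
    | more i ih0 ih1 =>
      intro hi
      have := hX (i + 1) (by omega)
      simp only [row, smul_eq_C_mul, ih0 (by omega), ih1 (by omega)] at this
      simp only [free, C_0] at this
      rw [orthoPoly]
      simp only [free, C_0] at this ⊢
      linear_combination -C (1 / 2)⁻¹ * this - v (i + 2) * h2
  rw [← h0]
  exact key i hi

theorem aeval_pC {K : Type*} [Field K] [Algebra ℝ K] [CharZero K] (J : JacobiData) {N : ℕ}
    (hJ : J.EqFreeOutside (N + 1)) {z : K} (hz : z ≠ 0) :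
    aeval ((z + z⁻¹) / 2) (J.pC (N + 1)) = aeval z (J.jost N) * aeval z⁻¹ (J.jost N) := by
  set s := (z + z⁻¹) / 2 with hs
  have hd : (J.jost N).natDegree < 2 * N + 2 := by have := J.natDegree_jost_le hJ; omega
  have key : ∀ i, 2 * N + 1 ≤ i → aeval z (free.firstLift i) * aeval s (J.pC (N + 1)) =
      ∑ m ∈ Finset.range (2 * N + 2), (J.jost N).coeff m • (z⁻¹ ^ m *
        aeval z (J.firstLift (i + m))) := by
    intro i hi
    have h := congrArg (aeval s)
      (J.sum_connection_mul hJ (M := i + (2 * N + 1)) i (by omega))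
    rw [show i + (2 * N + 1) + 1 = i + (2 * N + 2) by ring, Finset.sum_range_add,
      Finset.sum_eq_zero, zero_add] at h
    · rw [free.firstLift_eq hz, ← hs, mul_assoc, ← map_mul, ← h, map_sum, Finset.mul_sum]
      refine Finset.sum_congr rfl fun m _ => ?_
      rw [J.connection_eq_upperToeplitz hJ (by omega), upperToeplitz, if_pos (by omega),
        Nat.add_sub_cancel_left, J.firstLift_eq hz, ← hs, map_smul, mul_smul_comm, pow_add]
      congr 1
      have e3 : z ^ m * z⁻¹ ^ m = 1 := by rw [← mul_pow, mul_inv_cancel₀ hz, one_pow]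
      linear_combination -z ^ i * aeval s (J.orthoPoly (i + m)) * e3
    · intro k hk
      rw [J.connection_eq_zero _ (Finset.mem_range.1 hk), zero_smul]
  -- subtracting consecutive rows replaces the lifts by the constants `1` and `jost`
  have h1 := key (2 * N + 1) le_rfl
  have h2 := key (2 * N + 1 + 1) (by omega)
  rw [free_firstLift_succ, map_add, map_mul, map_one, map_pow, aeval_X] at h2
  have h3 : aeval s (J.pC (N + 1)) = ∑ m ∈ Finset.range (2 * N + 2), (J.jost N).coeff m •
      (z⁻¹ ^ m * aeval z (J.jost N)) := by
    have : ∀ m, aeval z (J.jost N) = aeval z (J.firstLift (2 * N + 1 + 1 + m)) -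
        z ^ 2 * aeval z (J.firstLift (2 * N + 1 + m)) := by
      intro m
      rw [← J.firstLift_jost hJ (k := 2 * N + 1 + m) (by omega)]
      simp [add_right_comm]
    calc aeval s (J.pC (N + 1)) =
        ∑ m ∈ Finset.range (2 * N + 2), (J.jost N).coeff m •
          (z⁻¹ ^ m * aeval z (J.firstLift (2 * N + 1 + 1 + m))) -
        z ^ 2 * ∑ m ∈ Finset.range (2 * N + 2), (J.jost N).coeff m •
          (z⁻¹ ^ m * aeval z (J.firstLift (2 * N + 1 + m))) := by
          linear_combination h2 - z ^ 2 * h1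
      _ = _ := by
        rw [Finset.mul_sum, ← Finset.sum_sub_distrib]
        refine Finset.sum_congr rfl fun m _ => ?_
        rw [this m, mul_smul_comm, ← smul_sub]
        congr 1
        ring
  rw [h3, mul_comm (aeval z (J.jost N)), aeval_eq_sum_range' hd (z⁻¹), Finset.sum_mul]
  simp only [smul_mul_assoc]

theorem natDegree_pC_le (J : JacobiData) (N : ℕ) : (J.pC (N + 1)).natDegree ≤ 2 * N + 1 := by
  refine natDegree_sum_le_of_forall_le _ _ fun k hk => (natDegree_C_mul_le _ _).trans ?_
  rw [natDegree_eq_of_degree_eq_some (J.degree_orthoPoly k)]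
  have := Finset.mem_range.1 hk
  omega

end JacobiData

/-! ### Roots between roots -/

/-- Between two consecutive roots at which a polynomial crosses zero in the same direction there
is a further root. -/
theorem Polynomial.exists_root_between {f : ℝ[X]} {a b : ℝ} (hab : a < b) (ha : f.eval a = 0)
    (hb : f.eval b = 0) (ha' : (derivative f).eval a < 0) (hb' : (derivative f).eval b < 0) :
    ∃ t ∈ Set.Ioo a b, f.eval t = 0 := by
  obtain ⟨g, rfl⟩ := dvd_iff_isRoot.2 (show IsRoot f a from ha)
  have hg : IsRoot g b := by
    simpa [sub_eq_zero, hab.ne'] using hb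
  obtain ⟨h, rfl⟩ := dvd_iff_isRoot.2 hg
  simp only [derivative_mul, derivative_sub, derivative_X, derivative_C, eval_add, eval_mul,
    eval_sub, eval_X, eval_C, sub_self, zero_mul, add_zero, sub_zero,
    one_mul, zero_add] at ha' hb'
  have h1 : 0 < h.eval a := by
    by_contra! hh
    nlinarith
  have h2 : h.eval b < 0 := by
    by_contra! hh
    nlinarith
  obtain ⟨t, ht, ht0⟩ := intermediate_value_Ioo' hab.le h.continuous.continuousOn
    (show (0 : ℝ) ∈ Set.Ioo (h.eval b) (h.eval a) from ⟨h2, h1⟩)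
  exact ⟨t, ht, by simp [ht0]⟩

theorem Polynomial.exists_roots_between {f : ℝ[X]} (S : Finset ℝ)
    (hS : ∀ a ∈ S, f.eval a = 0 ∧ (derivative f).eval a < 0) :
    ∃ T : Finset ℝ, S.card ≤ T.card + 1 ∧
      ∀ t ∈ T, f.eval t = 0 ∧ t ∉ S ∧ (∃ a ∈ S, a < t) ∧ ∃ b ∈ S, t < b := by
  induction S using Finset.induction_on_max with
  | empty => exact ⟨∅, by simp⟩
  | insert a S ha ih =>
    obtain ⟨T, hT, hT'⟩ := ih fun x hx => hS x (Finset.mem_insert_of_mem hx)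
    rcases S.eq_empty_or_nonempty with rfl | hne
    · exact ⟨∅, by simp⟩
    · have hm := S.max'_mem hne
      have hle := S.le_max'
      set m := S.max' hne
      obtain ⟨t, ⟨ht1, ht2⟩, ht0⟩ := exists_root_between (ha m hm)
        (hS m (Finset.mem_insert_of_mem hm)).1 (hS a (Finset.mem_insert_self _ _)).1
        (hS m (Finset.mem_insert_of_mem hm)).2 (hS a (Finset.mem_insert_self _ _)).2
      have htT : t ∉ T := fun h => by
        obtain ⟨b, hb, hb'⟩ := (hT' t h).2.2.2
        exact absurd (hle b hb) (by linarith)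
      refine ⟨insert t T, ?_, fun x hx => ?_⟩
      · rw [Finset.card_insert_of_notMem htT,
          Finset.card_insert_of_notMem fun h => lt_irrefl a (ha a h)]
        omega
      · rcases Finset.mem_insert.1 hx with rfl | hx
        · refine ⟨ht0, fun h => ?_, ⟨m, Finset.mem_insert_of_mem hm, ht1⟩,
            ⟨a, Finset.mem_insert_self _ _, ht2⟩⟩
          rcases Finset.mem_insert.1 h with rfl | h
          · exact lt_irrefl _ ht2
          · exact absurd (hle _ h) (by linarith)
        · obtain ⟨h0, h1, ⟨u, hu, hu'⟩, v, hv, hv'⟩ := hT' x hx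
          refine ⟨h0, fun h => ?_, ⟨u, Finset.mem_insert_of_mem hu, hu'⟩,
            ⟨v, Finset.mem_insert_of_mem hv, hv'⟩⟩
          rcases Finset.mem_insert.1 h with rfl | h
          · exact absurd (ha v hv) (by linarith)
          · exact h1 h

theorem Polynomial.aeval_ofReal_eq (p : ℝ[X]) (x : ℝ) :
    aeval (x : ℂ) p = ((p.eval x : ℝ) : ℂ) := by
  have := aeval_algebraMap_apply ℂ x p
  simpa using this

namespace JacobiData

/-! ### The roots of the Jost function -/

theorem firstLift_ne_zero_of_eq {K : Type*} [Field K] [Algebra ℝ K] [CharZero K] (J : JacobiData)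
    {N : ℕ} (hJ : J.EqFreeOutside (N + 1)) {z : K} (hz : z ≠ 0) {a : K}
    (h : aeval z (J.firstLift (N + 1)) = a * aeval z (J.firstLift N)) :
    aeval z (J.firstLift N) ≠ 0 := by
  intro h0
  have hw := J.wronskian_aeval hJ z
  rw [h, h0] at hw
  simp [hz] at hw

theorem aeval_jost {K : Type*} [Field K] [Algebra ℝ K] (J : JacobiData) (N : ℕ) (z : K) :
    aeval z (J.jost N) = aeval z (J.firstLift (N + 1)) - z ^ 2 * aeval z (J.firstLift N) := by
  simp [jost]

theorem ne_zero_of_aeval_jost (J : JacobiData) {N : ℕ} {z : ℂ} (h : aeval z (J.jost N) = 0) :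
    z ≠ 0 := by
  rintro rfl
  have := J.eval_zero_jost_pos N
  rw [← Complex.ofReal_zero, aeval_ofReal_eq, Complex.ofReal_inj] at h
  exact this.ne' h

theorem jost_root_of_norm_eq_one (J : JacobiData) {N : ℕ} (hJ : J.EqFreeOutside (N + 1)) {z : ℂ}
    (hz : ‖z‖ = 1) (h : aeval z (J.jost N) = 0) : z = 1 ∨ z = -1 := by
  have hz0 := J.ne_zero_of_aeval_jost h
  have h1 := J.jost_inv hz0 N
  have h2 : aeval z⁻¹ (J.jost N) = 0 := by
    rw [Complex.inv_eq_conj hz, Polynomial.aeval_conj, h, map_zero]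
  rw [aeval_jost] at h
  have h3 := J.firstLift_ne_zero_of_eq hJ hz0 (sub_eq_zero.1 h)
  rw [h2, mul_zero] at h1
  have h4 : (z ^ 2 - 1) * aeval z (J.firstLift N) = 0 := by linear_combination -h - h1
  exact sq_eq_one_iff.1 (sub_eq_zero.1 ((mul_eq_zero.1 h4).resolve_right h3))

theorem derivative_jost_ne_zero_of_sq_eq_one (J : JacobiData) {N : ℕ}
    (hJ : J.EqFreeOutside (N + 1)) {x : ℝ} (hx : x ^ 2 = 1) (h : (J.jost N).eval x = 0) :
    (derivative (J.jost N)).eval x ≠ 0 := by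
  have hx0 : x ≠ 0 := by rintro rfl; norm_num at hx
  have h1 := J.derivative_firstLift_of_sq_eq_one hx N
  have h2 := J.derivative_firstLift_of_sq_eq_one hx (N + 1)
  have h3 : (J.firstLift (N + 1)).eval x = (J.firstLift N).eval x := by
    have : (J.firstLift (N + 1)).eval x - x ^ 2 * (J.firstLift N).eval x = 0 := by
      simpa [jost] using h
    rwa [hx, one_mul, sub_eq_zero] at this
  have h4 : (J.firstLift N).eval x ≠ 0 :=
    J.firstLift_ne_zero_of_eq hJ hx0 (a := 1) (by simpa using h3)
  have h5 : (derivative (J.jost N)).eval x = -x * (J.firstLift N).eval x := by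
    simp only [jost, derivative_sub, derivative_mul, derivative_X_pow, eval_sub, eval_add,
      eval_mul, h1, h2, h3, eval_pow, eval_X, eval_C]
    push_cast
    norm_num
    linear_combination -N * x * (J.firstLift N).eval x * hx
  rw [h5]
  exact mul_ne_zero (neg_ne_zero.2 hx0) h4

theorem derivative_jost_ne_zero_of_norm_eq_one (J : JacobiData) {N : ℕ}
    (hJ : J.EqFreeOutside (N + 1)) {z : ℂ} (hz : ‖z‖ = 1) (h : aeval z (J.jost N) = 0) :
    aeval z (derivative (J.jost N)) ≠ 0 := by
  obtain ⟨x, hx, rfl⟩ : ∃ x : ℝ, x ^ 2 = 1 ∧ z = (x : ℂ) := by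
    rcases J.jost_root_of_norm_eq_one hJ hz h with rfl | rfl
    · exact ⟨1, by norm_num, by simp⟩
    · exact ⟨-1, by norm_num, by simp⟩
  rw [aeval_ofReal_eq, Complex.ofReal_eq_zero] at h
  rw [aeval_ofReal_eq, Complex.ofReal_ne_zero]
  exact J.derivative_jost_ne_zero_of_sq_eq_one hJ hx h

/-- A root of the Jost function in the unit disc is real: at such a root, Green's formula for the
orthonormal polynomials and their conjugates equates a negative and a nonnegative multiple of
the imaginary part of the root. -/
theorem im_eq_zero_of_aeval_jost (J : JacobiData) {N : ℕ} (hJ : J.EqFreeOutside (N + 1)) {z : ℂ}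
    (hz : ‖z‖ < 1) (h : aeval z (J.jost N) = 0) : z.im = 0 := by
  have hz0 := J.ne_zero_of_aeval_jost h
  set s := (z + z⁻¹) / 2 with hs
  set p : ℕ → ℂ := fun k => aeval s (J.orthoPoly k) with hp
  set q : ℕ → ℂ := fun k => aeval (starRingEnd ℂ s) (J.orthoPoly k) with hq
  have hpq : ∀ k, q k = starRingEnd ℂ (p k) := fun k => Polynomial.aeval_conj _ _
  have h1 : p (N + 1) = z * p N := by
    rw [aeval_jost, J.firstLift_eq hz0, J.firstLift_eq hz0, ← hs] at h
    refine mul_left_cancel₀ (pow_ne_zero (N + 1) hz0) ?_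
    linear_combination h
  have hg := J.green p q N
  simp only [hp, hq, row_aeval] at hg
  change ∑ k ∈ Finset.range (N + 1), (p k * (starRingEnd ℂ s * q k) - s * p k * q k) =
    J.β N • (p N * q (N + 1) - p (N + 1) * q N) at hg
  have e1 : ∀ k, p k * (starRingEnd ℂ s * q k) - s * p k * q k =
      (starRingEnd ℂ s - s) * ((Complex.normSq (p k) : ℝ) : ℂ) := by
    intro k
    rw [hpq, ← Complex.mul_conj]
    ring
  rw [Finset.sum_congr rfl fun k _ => e1 k, ← Finset.mul_sum, hJ.2 N (by omega), hpq, hpq, h1,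
    map_mul] at hg
  have e2 : p N * (starRingEnd ℂ z * starRingEnd ℂ (p N)) - z * p N * starRingEnd ℂ (p N) =
      (starRingEnd ℂ z - z) * ((Complex.normSq (p N) : ℝ) : ℂ) := by
    rw [← Complex.mul_conj]
    ring
  rw [e2, ← Complex.ofReal_sum, Complex.real_smul] at hg
  have hS : 1 ≤ ∑ k ∈ Finset.range (N + 1), Complex.normSq (p k) := by
    have := Finset.single_le_sum (f := fun k => Complex.normSq (p k))
      (fun k _ => Complex.normSq_nonneg _) (Finset.mem_range.2 N.succ_pos)
    simpa [hp, orthoPoly] using this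
  set S := ∑ k ∈ Finset.range (N + 1), Complex.normSq (p k)
  have hi := congrArg Complex.im hg
  simp only [Complex.mul_im, Complex.sub_im, Complex.conj_im, Complex.ofReal_re,
    Complex.ofReal_im, mul_zero, zero_mul, zero_add, add_zero] at hi
  have hsi : s.im = z.im * (1 - (Complex.normSq z)⁻¹) / 2 := by
    have : s = ((1 / 2 : ℝ) : ℂ) * (z + z⁻¹) := by rw [hs]; push_cast; ring
    rw [this, Complex.im_ofReal_mul, Complex.add_im, Complex.inv_im]
    ring
  have hn : 1 < (Complex.normSq z)⁻¹ := by
    have h0 : 0 < Complex.normSq z := Complex.normSq_pos.2 hz0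
    refine (one_lt_inv₀ h0).2 ?_
    rw [Complex.normSq_eq_norm_sq]
    have := norm_nonneg z
    nlinarith
  have hN := Complex.normSq_nonneg (p N)
  rw [hsi] at hi
  have hf : z.im * (((Complex.normSq z)⁻¹ - 1) * S + Complex.normSq (p N)) = 0 := by
    linear_combination hi
  refine (mul_eq_zero.1 hf).resolve_right (ne_of_gt ?_)
  have : 0 < ((Complex.normSq z)⁻¹ - 1) * S := mul_pos (by linarith) (by linarith)
  linarith

/-- The confluent form of the Christoffel–Darboux formula. -/
theorem sum_sq_orthoPoly (J : JacobiData) (N : ℕ) :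
    ∑ k ∈ Finset.range (N + 1), J.orthoPoly k ^ 2 = C (J.β N) *
      (derivative (J.orthoPoly (N + 1)) * J.orthoPoly N -
        derivative (J.orthoPoly N) * J.orthoPoly (N + 1)) := by
  have hg := J.green (fun k => derivative (J.orthoPoly k)) J.orthoPoly N
  have hr : ∀ k, J.row (fun k => derivative (J.orthoPoly k)) k =
      J.orthoPoly k + X * derivative (J.orthoPoly k) := by
    intro k
    have h := congrArg derivative (J.row_orthoPoly k)
    rw [derivative_mul, derivative_X, one_mul] at h
    rw [← h]
    cases k <;> simp [row]
  have e : ∀ k, derivative (J.orthoPoly k) * J.row J.orthoPoly k -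
      J.row (fun k => derivative (J.orthoPoly k)) k * J.orthoPoly k = -J.orthoPoly k ^ 2 := by
    intro k
    rw [hr, row_orthoPoly]
    ring
  rw [Finset.sum_congr rfl fun k _ => e k, Finset.sum_neg_distrib, smul_eq_C_mul] at hg
  linear_combination -hg

theorem hasDerivAt_joukowski {x : ℝ} (hx : x ≠ 0) :
    HasDerivAt (fun y : ℝ => (y + y⁻¹) / 2) ((1 + -(x ^ 2)⁻¹) / 2) x :=
  ((hasDerivAt_id x).add (hasDerivAt_inv hx)).div_const 2

theorem mul_derivative_firstLift (J : JacobiData) {x : ℝ} (hx : x ≠ 0) (k : ℕ) :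
    x * (derivative (J.firstLift k)).eval x = k * (J.firstLift k).eval x +
      x ^ k * ((x - x⁻¹) / 2) * (derivative (J.orthoPoly k)).eval ((x + x⁻¹) / 2) := by
  have h1 := (hasDerivAt_pow k x).mul
    (((J.orthoPoly k).hasDerivAt ((x + x⁻¹) / 2)).comp x (hasDerivAt_joukowski hx))
  have h2 : HasDerivAt (fun y => (J.firstLift k).eval y) _ x := (J.firstLift k).hasDerivAt x
  have h3 : (fun y => (J.firstLift k).eval y) =ᶠ[nhds x]
      ((fun y => y ^ k) * ((fun y => (J.orthoPoly k).eval y) ∘ fun y => (y + y⁻¹) / 2)) := by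
    filter_upwards [isOpen_ne.mem_nhds hx] with y hy
    simpa using J.firstLift_eq hy k
  have h4 := h2.unique (h1.congr_of_eventuallyEq h3)
  have h5 : (J.firstLift k).eval x = x ^ k * (J.orthoPoly k).eval ((x + x⁻¹) / 2) := by
    simpa using J.firstLift_eq hx k
  rw [h4, h5]
  cases k with
  | zero =>
    simp
    field_simp
    ring
  | succ k =>
    simp
    field_simp
    ring

/-- At a root `x` of the Jost function in the unit disc, the quantity `x c'(x) c(x⁻¹)` is
positive, since the Christoffel–Darboux formula expresses it by sums of squares. In particular
the root is simple. -/
theorem jost_weight_pos (J : JacobiData) {N : ℕ} (hJ : J.EqFreeOutside (N + 1)) {x : ℝ}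
    (hx : |x| < 1) (h : (J.jost N).eval x = 0) :
    0 < x * (derivative (J.jost N)).eval x * (J.jost N).eval x⁻¹ := by
  have hx0 : x ≠ 0 := by
    rintro rfl
    exact (J.eval_zero_jost_pos N).ne' h
  obtain ⟨s, hs⟩ : ∃ s, s = (x + x⁻¹) / 2 := ⟨_, rfl⟩
  have hd0 := J.mul_derivative_firstLift hx0 N
  have hd1 := J.mul_derivative_firstLift hx0 (N + 1)
  have hl0 : (J.firstLift N).eval x = _ := J.firstLift_eq hx0 N
  have hl1 : (J.firstLift (N + 1)).eval x = _ := J.firstLift_eq hx0 (N + 1)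
  have hi : x ^ (2 * N + 2) * (J.jost N).eval x⁻¹ =
    (J.firstLift (N + 1)).eval x - (J.firstLift N).eval x := J.jost_inv hx0 N
  have hc : (J.jost N).eval x = (J.firstLift (N + 1)).eval x - x ^ 2 * (J.firstLift N).eval x :=
    J.aeval_jost N x
  have hcd := congrArg (eval s) (J.sum_sq_orthoPoly N)
  rw [hJ.2 N (by omega)] at hcd
  simp only [eval_finsetSum, eval_pow, eval_mul, eval_sub, eval_C] at hcd
  have hS : 1 ≤ ∑ k ∈ Finset.range (N + 1), (J.orthoPoly k).eval s ^ 2 := by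
    have := Finset.single_le_sum (f := fun k => (J.orthoPoly k).eval s ^ 2)
      (fun k _ => sq_nonneg _) (Finset.mem_range.2 N.succ_pos)
    simpa [orthoPoly] using this
  have hder : x * (derivative (J.jost N)).eval x =
      x * (derivative (J.firstLift (N + 1))).eval x - 2 * x ^ 2 * (J.firstLift N).eval x -
        x ^ 2 * (x * (derivative (J.firstLift N)).eval x) := by
    simp only [jost, derivative_sub, derivative_mul, derivative_X_pow, eval_sub, eval_add,
      eval_mul, eval_pow, eval_X, eval_C]
    push_cast
    ring
  rw [coe_aeval_eq_eval, ← hs] at hl0 hl1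
  rw [← hs] at hd0 hd1
  generalize (∑ k ∈ Finset.range (N + 1), (J.orthoPoly k).eval s ^ 2) = S at *
  generalize (J.orthoPoly N).eval s = p at *
  generalize (J.orthoPoly (N + 1)).eval s = p₁ at *
  generalize (derivative (J.orthoPoly N)).eval s = q at *
  generalize (derivative (J.orthoPoly (N + 1))).eval s = q₁ at *
  generalize (J.jost N).eval x⁻¹ = c at *
  have hp : p₁ = x * p := by
    refine mul_left_cancel₀ (pow_ne_zero (N + 1) hx0) ?_
    linear_combination h - hc - hl1 + x ^ 2 * hl0
  have hi' : x ^ (N + 2) * c = (x ^ 2 - 1) * p := by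
    refine mul_left_cancel₀ (pow_ne_zero N hx0) ?_
    linear_combination hi + hl1 - hl0 + x ^ (N + 1) * hp
  have hW : x * (derivative (J.jost N)).eval x =
      x ^ (N + 1) * (-x * p + (x - x⁻¹) / 2 * (q₁ - x * q)) := by
    rw [hder, hd0, hd1, hl0, hl1, hp]
    push_cast
    ring
  have hxi : x * x⁻¹ = 1 := mul_inv_cancel₀ hx0
  have key : x * (derivative (J.jost N)).eval x * c =
      (1 - x ^ 2) * (p ^ 2 + (x⁻¹ ^ 2 - 1) * S) := by
    refine mul_left_cancel₀ hx0 ?_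
    rw [hW]
    rw [hp] at hcd
    linear_combination (-x * p + (x - x⁻¹) / 2 * (q₁ - x * q)) * hi'
      - (x ^ 2 - 1) * (x - x⁻¹) * hcd + (1 - x ^ 2) * S * (- x⁻¹) * hxi
  rw [key]
  have h1 : x ^ 2 < 1 := (sq_lt_one_iff_abs_lt_one x).2 hx
  have h2 : 1 < x⁻¹ ^ 2 := by
    rw [inv_pow]
    exact (one_lt_inv₀ (by positivity)).2 h1
  have h3 : 0 < (x⁻¹ ^ 2 - 1) * S := mul_pos (by linarith) (by linarith)
  have h4 := sq_nonneg p
  exact mul_pos (by linarith) (by linarith)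

theorem eval_pC (J : JacobiData) {N : ℕ} (hJ : J.EqFreeOutside (N + 1)) {x : ℝ} (hx : x ≠ 0) :
    (J.pC (N + 1)).eval ((x + x⁻¹) / 2) = (J.jost N).eval x * (J.jost N).eval x⁻¹ :=
  J.aeval_pC hJ hx

theorem derivative_pC (J : JacobiData) {N : ℕ} (hJ : J.EqFreeOutside (N + 1)) {x : ℝ}
    (hx : x ≠ 0) (h : (J.jost N).eval x = 0) :
    (derivative (J.pC (N + 1))).eval ((x + x⁻¹) / 2) * ((x - x⁻¹) / 2) =
      x * (derivative (J.jost N)).eval x * (J.jost N).eval x⁻¹ := by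
  have h1 := ((J.pC (N + 1)).hasDerivAt ((x + x⁻¹) / 2)).comp x (hasDerivAt_joukowski hx)
  have h2 := ((J.jost N).hasDerivAt x).mul
    (((J.jost N).hasDerivAt x⁻¹).comp x (hasDerivAt_inv hx))
  have h3 : ((fun y => (J.pC (N + 1)).eval y) ∘ fun y : ℝ => (y + y⁻¹) / 2) =ᶠ[nhds x]
      ((fun y => (J.jost N).eval y) * ((fun y => (J.jost N).eval y) ∘ fun y => y⁻¹)) := by
    filter_upwards [isOpen_ne.mem_nhds hx] with y hy
    exact J.eval_pC hJ hy
  have h4 := h1.unique (h2.congr_of_eventuallyEq h3)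
  simp only [h, Function.comp_apply, zero_mul, add_zero] at h4
  rw [mul_assoc, ← h4]
  field_simp
  ring

/-- The real roots of the Jost function in the open unit disc. -/
noncomputable def jostRoots (J : JacobiData) (N : ℕ) : Finset ℝ :=
  (J.jost N).roots.toFinset.filter fun x => |x| < 1

theorem jost_ne_zero (J : JacobiData) (N : ℕ) : J.jost N ≠ 0 := fun h => by
  have := J.eval_zero_jost_pos N
  simp [h] at this

theorem mem_jostRoots (J : JacobiData) {N : ℕ} {x : ℝ} :
    x ∈ J.jostRoots N ↔ (J.jost N).eval x = 0 ∧ |x| < 1 := by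
  simp [jostRoots, J.jost_ne_zero]

theorem ne_zero_of_mem_jostRoots (J : JacobiData) {N : ℕ} {x : ℝ} (h : x ∈ J.jostRoots N) :
    x ≠ 0 := by
  rintro rfl
  exact (J.eval_zero_jost_pos N).ne' (J.mem_jostRoots.1 h).1

theorem aeval_jost_eq_zero_iff (J : JacobiData) {N : ℕ} (hJ : J.EqFreeOutside (N + 1)) (w : ℂ) :
    ‖w‖ < 1 ∧ aeval w (J.jost N) = 0 ↔ ∃ x ∈ J.jostRoots N, w = (x : ℂ) := by
  constructor
  · rintro ⟨hw, h⟩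
    obtain ⟨x, rfl⟩ : ∃ x : ℝ, w = (x : ℂ) :=
      ⟨w.re, Complex.ext (by simp) (by simpa using J.im_eq_zero_of_aeval_jost hJ hw h)⟩
    refine ⟨x, J.mem_jostRoots.2 ⟨?_, by simpa using hw⟩, rfl⟩
    rwa [aeval_ofReal_eq, Complex.ofReal_eq_zero] at h
  · rintro ⟨x, hx, rfl⟩
    rw [mem_jostRoots] at hx
    exact ⟨by simpa using hx.2, by rw [aeval_ofReal_eq, hx.1, Complex.ofReal_zero]⟩

theorem derivative_pC_neg (J : JacobiData) {N : ℕ} (hJ : J.EqFreeOutside (N + 1)) {x : ℝ}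
    (hx : x ∈ J.jostRoots N) (h0 : 0 < x) :
    (derivative (J.pC (N + 1))).eval ((x + x⁻¹) / 2) < 0 := by
  obtain ⟨h, h1⟩ := J.mem_jostRoots.1 hx
  have hw := J.jost_weight_pos hJ h1 h
  rw [← J.derivative_pC hJ h0.ne' h] at hw
  have : 1 < x⁻¹ := (one_lt_inv₀ h0).2 (abs_lt.1 h1).2
  have := (abs_lt.1 h1).2
  by_contra! hh
  nlinarith

theorem derivative_pC_pos (J : JacobiData) {N : ℕ} (hJ : J.EqFreeOutside (N + 1)) {x : ℝ}
    (hx : x ∈ J.jostRoots N) (h0 : x < 0) :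
    0 < (derivative (J.pC (N + 1))).eval ((x + x⁻¹) / 2) := by
  obtain ⟨h, h1⟩ := J.mem_jostRoots.1 hx
  have hw := J.jost_weight_pos hJ h1 h
  rw [← J.derivative_pC hJ h0.ne h] at hw
  have h2 := (abs_lt.1 h1).1
  have : x⁻¹ < -1 := by
    rw [inv_lt_of_neg h0 (by norm_num)]
    norm_num
    exact h2
  by_contra! hh
  nlinarith

theorem joukowski_injOn : Set.InjOn (fun x : ℝ => (x + x⁻¹) / 2) {x | x ≠ 0 ∧ |x| < 1} := by
  rintro x ⟨hx, hx1⟩ y ⟨hy, hy1⟩ h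
  have h : (x + x⁻¹) / 2 = (y + y⁻¹) / 2 := h
  have h2 : (x - y) * (x * y - 1) = 0 := by
    field_simp at h
    linear_combination h
  rcases mul_eq_zero.1 h2 with h3 | h3
  · linarith
  · have : |x| * |y| < 1 := by
      have := abs_nonneg x
      have := abs_nonneg y
      nlinarith
    rw [← abs_mul, sub_eq_zero.1 h3, abs_one] at this
    exact absurd this (lt_irrefl _)

/-- On the cut, `p_C` is the squared modulus of the Jost function. -/
theorem pC_cos (J : JacobiData) {N : ℕ} (hJ : J.EqFreeOutside (N + 1)) (t : ℝ) :
    (J.pC (N + 1)).eval (Real.cos t) = Complex.normSq (aeval (circleMap 0 1 t) (J.jost N)) := by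
  have h1 : ‖circleMap 0 1 t‖ = 1 := by simp
  have h := J.aeval_pC hJ (z := circleMap 0 1 t) (by simp)
  rw [Complex.inv_eq_conj h1, Polynomial.aeval_conj, Complex.mul_conj] at h
  have e : (circleMap 0 1 t + starRingEnd ℂ (circleMap 0 1 t)) / 2 = (Real.cos t : ℂ) := by
    rw [Complex.add_conj]
    simp [circleMap, Complex.exp_ofReal_mul_I_re]
  rw [e, aeval_ofReal_eq] at h
  exact_mod_cast h

theorem pC_pos (J : JacobiData) {N : ℕ} (hJ : J.EqFreeOutside (N + 1)) {s : ℝ}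
    (hs : s ∈ Set.Ioo (-1 : ℝ) 1) : 0 < (J.pC (N + 1)).eval s := by
  rw [← Real.cos_arccos hs.1.le hs.2.le, J.pC_cos hJ, Complex.normSq_pos]
  intro h
  have hc : (circleMap 0 1 (Real.arccos s)).re = s := by
    simp [circleMap, Complex.exp_ofReal_mul_I_re, Real.cos_arccos hs.1.le hs.2.le]
  rcases J.jost_root_of_norm_eq_one hJ (by simp) h with h1 | h1
  · rw [h1] at hc
    simp at hc
    linarith [hs.2]
  · rw [h1] at hc
    simp at hc
    linarith [hs.1]

theorem pC_ne_zero (J : JacobiData) {N : ℕ} (hJ : J.EqFreeOutside (N + 1)) :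
    J.pC (N + 1) ≠ 0 := fun h => by
  have := J.pC_pos hJ (s := 0) (by norm_num)
  simp [h] at this

/-- The number of roots of the Jost function in the unit disc is at most the size of the
perturbed block. The roots correspond to roots of `p_C` outside `[-1, 1]`; as `p_C` crosses zero
in the same direction at all those on one side, it has further roots between them, and its
degree is too small for more than `N + 1`. -/
theorem card_jostRoots_le (J : JacobiData) {N : ℕ} (hJ : J.EqFreeOutside (N + 1)) :
    (J.jostRoots N).card ≤ N + 1 := by
  classical
  set f := J.pC (N + 1)
  set l : ℝ → ℝ := fun x => (x + x⁻¹) / 2 with hl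
  set R := J.jostRoots N
  set A := (R.filter fun x => 0 < x).image l with hA
  set B := (R.filter fun x => ¬ 0 < x).image l with hB
  have hinj : Set.InjOn l R := joukowski_injOn.mono fun x (hx : x ∈ R) =>
    show x ≠ 0 ∧ |x| < 1 from ⟨J.ne_zero_of_mem_jostRoots hx, (J.mem_jostRoots.1 hx).2⟩
  have hcard : A.card + B.card = R.card := by
    have hsub : ∀ P : ℝ → Prop, [DecidablePred P] → Set.InjOn l (R.filter P) := fun P _ =>
      hinj.mono (Finset.coe_subset.2 (Finset.filter_subset _ _))
    rw [hA, hB, Finset.card_image_of_injOn (hsub _), Finset.card_image_of_injOn (hsub _),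
      Finset.card_filter_add_card_filter_not]
  have hroot : ∀ x ∈ R, f.eval (l x) = 0 := fun x hx => by
    rw [J.eval_pC hJ (J.ne_zero_of_mem_jostRoots hx), (J.mem_jostRoots.1 hx).1, zero_mul]
  have hA' : ∀ a ∈ A, 0 < a ∧ f.eval a = 0 ∧ (derivative f).eval a < 0 := by
    intro a ha
    obtain ⟨x, hx, rfl⟩ := Finset.mem_image.1 ha
    rw [Finset.mem_filter] at hx
    have := hx.2
    exact ⟨by positivity, hroot x hx.1, J.derivative_pC_neg hJ hx.1 hx.2⟩
  have hB' : ∀ a ∈ B, a < 0 ∧ f.eval a = 0 ∧ 0 < (derivative f).eval a := by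
    intro a ha
    obtain ⟨x, hx, rfl⟩ := Finset.mem_image.1 ha
    rw [Finset.mem_filter] at hx
    have h0 : x < 0 := lt_of_le_of_ne (not_lt.1 hx.2) (J.ne_zero_of_mem_jostRoots hx.1)
    have := inv_lt_zero.2 h0
    exact ⟨by simp only [hl]; linarith, hroot x hx.1, J.derivative_pC_pos hJ hx.1 h0⟩
  obtain ⟨T, hT, hT'⟩ := exists_roots_between (f := f) A fun a ha => (hA' a ha).2
  obtain ⟨U, hU, hU'⟩ := exists_roots_between (f := -f) B fun a ha => by
    simpa using (hB' a ha).2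
  have hdAT : Disjoint A T := Finset.disjoint_left.2 fun a ha ht => (hT' a ht).2.1 ha
  have hdBU : Disjoint B U := Finset.disjoint_left.2 fun a ha ht => (hU' a ht).2.1 ha
  have hpos : ∀ a ∈ A ∪ T, 0 < a ∧ f.eval a = 0 := by
    intro a ha
    rcases Finset.mem_union.1 ha with ha | ha
    · exact ⟨(hA' a ha).1, (hA' a ha).2.1⟩
    · obtain ⟨h0, -, ⟨b, hb, hba⟩, -⟩ := hT' a ha
      exact ⟨(hA' b hb).1.trans hba, h0⟩
  have hneg : ∀ a ∈ B ∪ U, a < 0 ∧ f.eval a = 0 := by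
    intro a ha
    rcases Finset.mem_union.1 ha with ha | ha
    · exact ⟨(hB' a ha).1, (hB' a ha).2.1⟩
    · obtain ⟨h0, -, -, ⟨b, hb, hba⟩⟩ := hU' a ha
      exact ⟨hba.trans (hB' b hb).1, by simpa using h0⟩
  have hd : Disjoint (A ∪ T) (B ∪ U) := Finset.disjoint_left.2 fun a h1 h2 =>
    lt_asymm (hpos a h1).1 (hneg a h2).1
  have hle : ((A ∪ T) ∪ (B ∪ U)).card ≤ 2 * N + 1 := by
    refine (Finset.card_le_card (t := f.roots.toFinset) fun a ha => ?_).trans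
      ((Multiset.toFinset_card_le _).trans ((card_roots' _).trans (J.natDegree_pC_le N)))
    rw [Multiset.mem_toFinset, mem_roots (J.pC_ne_zero hJ)]
    rcases Finset.mem_union.1 ha with ha | ha
    · exact (hpos a ha).2
    · exact (hneg a ha).2
  rw [Finset.card_union_of_disjoint hd, Finset.card_union_of_disjoint hdAT,
    Finset.card_union_of_disjoint hdBU] at hle
  omega

/-! ### The resolvent -/

/-- The first column of the resolvent, as a solution of the recurrence. -/
theorem exists_resolvent_vector (J : JacobiData) {l : ℂ} (hl : l ∉ spectrum ℂ J.op) :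
    ∃ u : EllTwo, u 0 = J.principalResolvent l ∧ J.act u 0 - l * u 0 = 1 ∧
      ∀ k, J.act u (k + 1) = l * u (k + 1) := by
  have hu : IsUnit (J.op - l • (1 : EllTwo →L[ℂ] EllTwo)) := by
    have h := (spectrum.notMem_iff.1 hl).neg
    rwa [neg_sub, Algebra.algebraMap_eq_smul_one] at h
  set u := Ring.inverse (J.op - l • (1 : EllTwo →L[ℂ] EllTwo)) e0 with hu'
  have h1 : (J.op - l • (1 : EllTwo →L[ℂ] EllTwo)) u = e0 := by
    rw [hu', ← mul_apply_eq_comp, Ring.mul_inverse_cancel _ hu,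
      one_apply_eq_self]
  have h2 : ∀ k, J.act u k - l * u k = e0 k := fun k => by
    rw [← h1]
    rfl
  refine ⟨u, ?_, ?_, fun k => ?_⟩
  · rw [principalResolvent, ← hu', e0, lp.inner_single_left]
    simp
  · rw [h2, e0]
    simp
  · have h3 : (e0 : ℕ → ℂ) (k + 1) = 0 := by simp [e0]
    rw [← sub_eq_zero, h2, h3]

/-- The entries of a resolvent vector in terms of the lifted polynomials. -/
theorem resolvent_vector_eq (J : JacobiData) {u : ℕ → ℂ} {z : ℂ} (hz : z ≠ 0)
    (h0 : J.act u 0 - (z + z⁻¹) / 2 * u 0 = 1)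
    (h : ∀ k, J.act u (k + 1) = (z + z⁻¹) / 2 * u (k + 1)) (k : ℕ) :
    z ^ k * u k = z * aeval z (J.secondLift k) + u 0 * aeval z (J.firstLift k) := by
  have hb : ∀ k, ((J.β k)⁻¹ : ℂ) * (J.β k : ℂ) = 1 := fun k =>
    inv_mul_cancel₀ (Complex.ofReal_ne_zero.2 (J.β_pos k).ne')
  have e : z * ((z + z⁻¹) / 2) = 1 / 2 * (z ^ 2 + 1) := by field_simp
  induction k using Nat.twoStepInduction with
  | zero => simp [firstLift, secondLift, lift]
  | one =>
    simp only [act] at h0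
    simp [firstLift, secondLift, lift]
    linear_combination z * (J.β 0 : ℂ)⁻¹ * h0 - z * u 1 * hb 0 + (J.β 0 : ℂ)⁻¹ * u 0 * e
  | more k ih0 ih1 =>
    have hk := h k
    simp only [act] at hk
    simp only [firstLift, secondLift] at ih0 ih1 ⊢
    simp only [lift, map_mul, map_sub, map_add, map_pow, map_one, aeval_C, aeval_X,
      Complex.coe_algebraMap]
    push_cast
    linear_combination z ^ (k + 2) * (J.β (k + 1) : ℂ)⁻¹ * hk - z ^ (k + 2) * u (k + 2) * hb (k + 1)
      + (J.β (k + 1) : ℂ)⁻¹ * z ^ (k + 1) * u (k + 1) * e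
      + (J.β (k + 1) : ℂ)⁻¹ * (1 / 2 * (z ^ 2 + 1) - J.α (k + 1) * z) * ih1
      - (J.β (k + 1) : ℂ)⁻¹ * J.β k * z ^ 2 * ih0

/-- A point outside the spectrum is the Joukowski image of a point of the open unit disc at which
the Jost function does not vanish, and the resolvent there is a quotient of Jost functions:
square summability leaves no multiple of the growing (or, on the unit circle, of the
oscillating) solution of the recurrence. -/
theorem principalResolvent_eq (J : JacobiData) {N : ℕ} (hJ : J.EqFreeOutside (N + 1)) {l : ℂ}
    (hl : l ∉ spectrum ℂ J.op) :
    ∃ z : ℂ, z ≠ 0 ∧ ‖z‖ < 1 ∧ (z + z⁻¹) / 2 = l ∧ aeval z (J.jost N) ≠ 0 ∧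
      J.principalResolvent l = -(z * aeval z (J.secondJost N) / aeval z (J.jost N)) := by
  obtain ⟨z, hz, hz1, rfl⟩ := exists_joukowski_eq l
  obtain ⟨u, hu, h0, h⟩ := J.exists_resolvent_vector hl
  have hv := J.resolvent_vector_eq hz h0 h
  rw [hu] at hv
  set G := J.principalResolvent ((z + z⁻¹) / 2)
  have hlim : Filter.Tendsto (fun k => ‖u k‖) Filter.atTop (nhds 0) := by
    have := (summable_sq u).tendsto_atTop_zero.sqrt
    simpa using this
  have hk : ∀ k, N ≤ k → z ^ (k + 1) * (u (k + 1) - z * u k) =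
      z * aeval z (J.secondJost N) + G * aeval z (J.jost N) := by
    intro k hk
    rw [← J.firstLift_jost hJ hk, ← J.secondLift_jost hJ hk]
    simp only [map_sub, map_mul, map_pow, aeval_X]
    linear_combination hv (k + 1) - z ^ 2 * hv k
  -- the right-hand side above does not depend on `k`, and the left-hand side tends to zero
  have hD : z * aeval z (J.secondJost N) + G * aeval z (J.jost N) = 0 := by
    have h1 : Filter.Tendsto (fun k => ‖u (k + 1)‖ + ‖u k‖) Filter.atTop (nhds 0) := by
      simpa using (hlim.comp (Filter.tendsto_add_atTop_nat 1)).add hlim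
    refine norm_le_zero_iff.1 (ge_of_tendsto h1 ?_)
    filter_upwards [Filter.eventually_ge_atTop N] with k hkN
    rw [← hk k hkN, norm_mul, norm_pow]
    calc ‖z‖ ^ (k + 1) * ‖u (k + 1) - z * u k‖ ≤ 1 * ‖u (k + 1) - z * u k‖ := by
          gcongr
          exact pow_le_one₀ (norm_nonneg _) hz1
      _ ≤ ‖u (k + 1)‖ + ‖z‖ * ‖u k‖ := by
          rw [one_mul, ← norm_mul]
          exact norm_sub_le _ _
      _ ≤ ‖u (k + 1)‖ + ‖u k‖ := by
          gcongr
          exact mul_le_of_le_one_left (norm_nonneg _) hz1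
  have hw := J.wronskian_aeval hJ z
  have hw0 : (2 : ℂ) * z ^ (2 * N) ≠ 0 := mul_ne_zero two_ne_zero (pow_ne_zero _ hz)
  have hlt : ‖z‖ < 1 := by
    refine lt_of_le_of_ne hz1 fun h1 => hw0 ?_
    -- on the unit circle the entries of `u` would have constant modulus, hence vanish
    have hc : ∀ k, N ≤ k → u (k + 1) = z * u k := fun k hkN => by
      have := hk k hkN
      rw [hD, mul_eq_zero] at this
      exact sub_eq_zero.1 (this.resolve_left (pow_ne_zero _ hz))
    have hcN : ∀ k, N ≤ k → ‖u k‖ = ‖u N‖ := by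
      intro k hkN
      induction k, hkN using Nat.le_induction with
      | base => rfl
      | succ k hkN ih => rw [hc k hkN, norm_mul, h1, one_mul, ih]
    have h2 : ‖u N‖ = 0 := by
      refine tendsto_nhds_unique (tendsto_const_nhds.congr' ?_) hlim
      filter_upwards [Filter.eventually_ge_atTop N] with k hkN
      exact (hcN k hkN).symm
    have hN := hv N
    have hN1 := hv (N + 1)
    rw [hc N le_rfl] at hN1
    rw [norm_eq_zero.1 h2] at hN hN1
    refine mul_left_cancel₀ hz ?_
    linear_combination -z * hw + aeval z (J.firstLift (N + 1)) * hN
      - aeval z (J.firstLift N) * hN1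
  have hc : aeval z (J.jost N) ≠ 0 := by
    intro hc
    refine hw0 ?_
    rw [hc, mul_zero, add_zero, mul_eq_zero] at hD
    have hd := hD.resolve_left hz
    simp only [jost, secondJost, map_sub, map_mul, map_pow, aeval_X] at hc hd
    linear_combination -hw + aeval z (J.firstLift N) * hd - aeval z (J.secondLift N) * hc
  refine ⟨z, hz, hlt, rfl, hc, ?_⟩
  rw [eq_neg_iff_add_eq_zero]
  field_simp
  linear_combination hD

end JacobiData

/-! ### A residue formula -/

/-- The residue theorem on the unit disc for a quotient whose denominator is a polynomial with
only simple zeros in the closed disc, none of them on the circle. -/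
theorem circleIntegral_div_polynomial {D : ℂ[X]} {S : Finset ℂ} (hne : S.Nonempty)
    (hS : ∀ w, ‖w‖ ≤ 1 → (D.eval w = 0 ↔ w ∈ S)) (hS1 : ∀ w ∈ S, ‖w‖ < 1)
    (hD : ∀ w ∈ S, (derivative D).eval w ≠ 0) {f : ℂ → ℂ}
    (hf : DiffContOnCl ℂ f (Metric.ball 0 1)) :
    ∮ z in C(0, 1), f z / D.eval z =
      2 * Real.pi * Complex.I * ∑ w ∈ S, f w / (derivative D).eval w := by
  obtain ⟨q, hq⟩ : Lagrange.nodal S id ∣ D := by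
    rw [Lagrange.nodal]
    refine Finset.prod_dvd_of_coprime
      ((pairwise_coprime_X_sub_C Function.injective_id).set_pairwise _) fun w hw => ?_
    exact dvd_iff_isRoot.2 ((hS w (hS1 w hw).le).2 hw)
  have hder : ∀ w ∈ S, (derivative D).eval w =
      (derivative (Lagrange.nodal S id)).eval w * q.eval w := by
    intro w hw
    rw [hq, derivative_mul, eval_add, eval_mul, eval_mul,
      show (Lagrange.nodal S (id : ℂ → ℂ)).eval w = 0 from
        Lagrange.eval_nodal_at_node (v := (id : ℂ → ℂ)) hw]
    ring
  have hq0 : ∀ w, ‖w‖ ≤ 1 → q.eval w ≠ 0 := by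
    intro w hw h
    have h1 : w ∈ S := (hS w hw).1 (by rw [hq, eval_mul, h, mul_zero])
    exact hD w h1 (by rw [hder w h1, h, mul_zero])
  have hg : DiffContOnCl ℂ (fun z => (q.eval z)⁻¹ * f z) (Metric.ball 0 1) := by
    refine DiffContOnCl.smul (DiffContOnCl.inv q.differentiable.diffContOnCl fun z hz => ?_) hf
    rw [closure_ball _ one_ne_zero, mem_closedBall_zero_iff] at hz
    exact hq0 z hz
  have hlag : ∀ z ∈ Metric.sphere (0 : ℂ) 1, f z / D.eval z =
      ∑ w ∈ S, Lagrange.nodalWeight S id w * ((z - w)⁻¹ • ((q.eval z)⁻¹ * f z)) := by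
    intro z hz
    have hz1 : ‖z‖ = 1 := mem_sphere_zero_iff_norm.1 hz
    have hzS : ∀ i ∈ S, z ≠ id i := by
      rintro i hi rfl
      exact absurd hz1 (hS1 _ hi).ne
    have h := Lagrange.eval_interpolate_not_at_node (s := S) (v := (id : ℂ → ℂ)) 1 hzS
    rw [Lagrange.interpolate_one (Set.injOn_id _) hne, eval_one] at h
    have hn : (Lagrange.nodal S (id : ℂ → ℂ)).eval z ≠ 0 := by
      intro h0
      rw [h0, zero_mul] at h
      exact one_ne_zero h
    have h2 : ((Lagrange.nodal S (id : ℂ → ℂ)).eval z)⁻¹ =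
        ∑ w ∈ S, Lagrange.nodalWeight S id w * (z - w)⁻¹ := by
      rw [inv_eq_of_mul_eq_one_right h.symm]
      simp
    rw [hq, eval_mul, div_eq_mul_inv, mul_inv, h2, Finset.sum_mul, Finset.mul_sum]
    refine Finset.sum_congr rfl fun w _ => ?_
    rw [smul_eq_mul]
    ring
  rw [circleIntegral.integral_congr zero_le_one hlag, circleIntegral.integral_fun_sum,
    Finset.mul_sum]
  · refine Finset.sum_congr rfl fun w hw => ?_
    rw [circleIntegral.integral_const_mul, hg.circleIntegral_sub_inv_smul
      (by simpa using hS1 w hw), hder w hw, Lagrange.nodalWeight_eq_eval_derivative_nodal hw,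
      smul_eq_mul, id]
    field_simp
  · intro w hw
    refine ContinuousOn.circleIntegrable zero_le_one ?_
    have hgs := hg.continuousOn_ball.mono Metric.sphere_subset_closedBall
    refine continuousOn_const.mul (ContinuousOn.fun_smul
      (ContinuousOn.inv₀ (by fun_prop) fun z hz h0 => ?_) hgs)
    have hz1 : ‖z‖ = 1 := mem_sphere_zero_iff_norm.1 hz
    rw [sub_eq_zero.1 h0] at hz1
    exact absurd hz1 (hS1 _ hw).ne

theorem Polynomial.aeval_eq_eval_map (p : ℝ[X]) (z : ℂ) :
    aeval z p = (p.map (algebraMap ℝ ℂ)).eval z := by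
  rw [aeval_def, eval_map]

theorem Polynomial.differentiable_aeval_complex (p : ℝ[X]) :
    Differentiable ℂ fun z : ℂ => aeval z p := by
  simp only [aeval_eq_eval_map]
  exact (p.map (algebraMap ℝ ℂ)).differentiable

namespace JacobiData

/-! ### The contour integral of the density -/

/-- The zeros of the Jost function at `±1` cancel against `1 - z ^ 2`: with `g` the greatest common
divisor of the two, the quotient
`(1 - z ^ 2) / c` equals `e / q`, where the zeros of `q` in the closed disc are those of `c` in
the open disc. -/
theorem exists_jost_cancel (J : JacobiData) {N : ℕ} (hJ : J.EqFreeOutside (N + 1)) :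
    ∃ g e q : ℝ[X], J.jost N = g * q ∧ 1 - X ^ 2 = g * e ∧
      ∀ z : ℂ, ‖z‖ ≤ 1 → (aeval z q = 0 ↔ ‖z‖ < 1 ∧ aeval z (J.jost N) = 0) := by
  let _ := EuclideanDomain.gcdMonoid ℝ[X]
  obtain ⟨q, e, hq, he, hu⟩ := extract_gcd (J.jost N) (1 - X ^ 2)
  rw [gcd_isUnit_iff] at hu
  set g := GCDMonoid.gcd (J.jost N) (1 - X ^ 2)
  refine ⟨g, e, q, hq, he, fun z hz => ⟨fun h => ?_, fun ⟨hz1, h⟩ => ?_⟩⟩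
  · have hc : aeval z (J.jost N) = 0 := by rw [hq, map_mul, h, mul_zero]
    refine ⟨lt_of_le_of_ne hz fun hz1 => ?_, hc⟩
    have hd := J.derivative_jost_ne_zero_of_norm_eq_one hJ hz1 hc
    have hg : aeval z g ≠ 0 := by
      intro hg
      rw [hq, derivative_mul, map_add, map_mul, map_mul, h, hg] at hd
      simp at hd
    have h2 := congrArg (aeval z) he
    have hz2 : z ^ 2 = 1 := sq_eq_one_iff.2 (J.jost_root_of_norm_eq_one hJ hz1 hc)
    simp only [map_sub, map_mul, map_one, map_pow, aeval_X, hz2, sub_self] at h2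
    have he0 := (mul_eq_zero.1 h2.symm).resolve_left hg
    obtain ⟨a, b, hab⟩ := hu
    have h3 := congrArg (aeval z) hab
    simp [h, he0] at h3
  · have h2 := congrArg (aeval z) he
    rw [hq, map_mul] at h
    refine (mul_eq_zero.1 h).resolve_left fun hg => ?_
    simp only [map_sub, map_mul, map_one, map_pow, aeval_X, hg, zero_mul] at h2
    have h3 : ‖z ^ 2‖ = 1 := by rw [← sub_eq_zero.1 h2, norm_one]
    rw [norm_pow] at h3
    have := norm_nonneg z
    nlinarith

/-- The residue of the integrand of `integral_density` at a root of the Jost function is a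
multiple of the corresponding weight. -/
theorem jost_residue (J : JacobiData) {N : ℕ} (hJ : J.EqFreeOutside (N + 1)) {g e q : ℝ[X]}
    (hq : J.jost N = g * q) (he : 1 - X ^ 2 = g * e) {x : ℝ} (hx : x ∈ J.jostRoots N)
    (hqx : q.eval x = 0) :
    (derivative q).eval x ≠ 0 ∧
    e.eval x * (J.secondJost N).eval x / (derivative q).eval x =
      -2 * diracWeight (J.jost N) x * x := by
  obtain ⟨hc, hx1⟩ := J.mem_jostRoots.1 hx
  have hx0 := J.ne_zero_of_mem_jostRoots hx
  have hw := J.jost_weight_pos hJ hx1 hc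
  have hcd : (derivative (J.jost N)).eval x ≠ 0 := fun h => by simp [h] at hw
  have hci : (J.jost N).eval x⁻¹ ≠ 0 := fun h => by simp [h] at hw
  have h1 : (derivative (J.jost N)).eval x = g.eval x * (derivative q).eval x := by
    rw [hq, derivative_mul, eval_add, eval_mul, eval_mul, hqx, mul_zero, zero_add]
  have h3 : 1 - x ^ 2 = g.eval x * e.eval x := by simpa using congrArg (eval x) he
  have h2 : (J.jost N).eval x * (x⁻¹ * (J.secondJost N).eval x⁻¹) -
      x * (J.secondJost N).eval x * (J.jost N).eval x⁻¹ = 2 * (x⁻¹ - x) :=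
    J.jost_wronskian hJ hx0
  rw [hc, zero_mul, zero_sub] at h2
  have h2' : x ^ 2 * (J.secondJost N).eval x * (J.jost N).eval x⁻¹ = -2 * (1 - x ^ 2) := by
    have : x * x⁻¹ = 1 := mul_inv_cancel₀ hx0
    linear_combination -x * h2 - 2 * this
  have hg : g.eval x ≠ 0 := fun h => hcd (by rw [h1, h, zero_mul])
  have hqd : (derivative q).eval x ≠ 0 := fun h => hcd (by rw [h1, h, mul_zero])
  refine ⟨hqd, ?_⟩
  rw [diracWeight, h1]
  generalize (J.jost N).eval x⁻¹ = c' at *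
  generalize (J.secondJost N).eval x = d at *
  field_simp
  linear_combination (1 - x ^ 2) * h2' - x ^ 2 * d * c' * h3

/-- The integral of the density against a function of `(z + z⁻¹) / 2` that has a single
pole `ζ` in the disc. Since the density is a combination of `z d / c` and its value at `z⁻¹`
(`jost_wronskian`), the integral is a contour integral of `z d / c`, whose poles are `ζ` and the
roots of the Jost function. -/
theorem integral_density (J : JacobiData) {N : ℕ} (hJ : J.EqFreeOutside (N + 1)) {ζ : ℂ}
    (hζ : ‖ζ‖ < 1) (hcζ : aeval ζ (J.jost N) ≠ 0) {k h : ℂ → ℂ}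
    (hk : DiffContOnCl ℂ k (Metric.ball 0 1))
    (hh : ∀ z, z ≠ 0 → ‖z‖ ≤ 1 → z ≠ ζ → h ((z + z⁻¹) / 2) = z * k z / (z - ζ)) :
    IntegrableOn (fun t : ℝ => (2 / Real.pi * Real.sin t ^ 2 /
      (J.pC (N + 1)).eval (Real.cos t)) • h (Real.cos t)) (Set.Ioo 0 Real.pi) ∧
    ∫ t in Set.Ioo 0 Real.pi, (2 / Real.pi * Real.sin t ^ 2 /
      (J.pC (N + 1)).eval (Real.cos t)) • h (Real.cos t) =
      (1 - ζ ^ 2) * aeval ζ (J.secondJost N) * k ζ / (2 * aeval ζ (J.jost N)) -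
        ∑ x ∈ J.jostRoots N, (diracWeight (J.jost N) x : ℂ) * h ((x + (x : ℂ)⁻¹) / 2) := by
  classical
  obtain ⟨g, e, q, hq, he, hqz⟩ := J.exists_jost_cancel hJ
  have heq : ∀ z : ℂ, (1 - z ^ 2) * aeval z q = aeval z e * aeval z (J.jost N) := by
    intro z
    have h2 := congrArg (aeval z) he
    simp only [map_sub, map_mul, map_one, map_pow, aeval_X] at h2
    rw [h2, hq, map_mul]
    ring
  set D : ℂ[X] := (X - C ζ) * q.map (algebraMap ℝ ℂ) with hDdef
  have hDev : ∀ w, D.eval w = (w - ζ) * aeval w q := by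
    intro w
    rw [hDdef, eval_mul, ← aeval_eq_eval_map]
    simp
  have hDder : ∀ w, (derivative D).eval w = aeval w q + (w - ζ) * aeval w (derivative q) := by
    intro w
    rw [hDdef, derivative_mul, eval_add, eval_mul, eval_mul, derivative_map,
      ← aeval_eq_eval_map, ← aeval_eq_eval_map]
    simp
  set R := J.jostRoots N
  have hR : ∀ x ∈ R, (x : ℂ) ≠ ζ ∧ aeval (x : ℂ) q = 0 ∧ ‖(x : ℂ)‖ < 1 := by
    intro x hx
    have h1 := (J.aeval_jost_eq_zero_iff hJ x).2 ⟨x, hx, rfl⟩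
    refine ⟨?_, (hqz _ h1.1.le).2 h1, h1.1⟩
    rintro rfl
    exact hcζ h1.2
  have hqζ : aeval ζ q ≠ 0 := fun h0 => hcζ ((hqz ζ hζ.le).1 h0).2
  set S : Finset ℂ := insert ζ (R.image fun x : ℝ => (x : ℂ)) with hSdef
  have hres := circleIntegral_div_polynomial (D := D) (S := S) ⟨ζ, by simp [hSdef]⟩
    (fun w hw => by
      rw [hDev, mul_eq_zero, sub_eq_zero, hqz w hw, J.aeval_jost_eq_zero_iff hJ, hSdef]
      simp [eq_comm, R])
    (fun w hw => by
      rcases Finset.mem_insert.1 hw with rfl | hw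
      · exact hζ
      · obtain ⟨x, hx, rfl⟩ := Finset.mem_image.1 hw
        exact (hR x hx).2.2)
    (fun w hw => by
      rw [hDder]
      rcases Finset.mem_insert.1 hw with rfl | hw
      · simpa using hqζ
      · obtain ⟨x, hx, rfl⟩ := Finset.mem_image.1 hw
        obtain ⟨h1, h2, h3⟩ := hR x hx
        rw [h2, zero_add, aeval_ofReal_eq]
        rw [aeval_ofReal_eq, Complex.ofReal_eq_zero] at h2
        exact mul_ne_zero (sub_ne_zero.2 h1)
          (Complex.ofReal_ne_zero.2 (J.jost_residue hJ hq he hx h2).1))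
    (f := fun z => aeval z e * aeval z (J.secondJost N) * k z)
    (DiffContOnCl.smul ((differentiable_aeval_complex e).mul
      (differentiable_aeval_complex (J.secondJost N))).diffContOnCl hk)
  set G : ℂ → ℂ := fun z => aeval z e * aeval z (J.secondJost N) * k z / D.eval z with hG
  set F : ℝ → ℂ := fun t => circleMap 0 1 t * G (circleMap 0 1 t) with hF
  have hnorm : ∀ t, ‖circleMap 0 1 t‖ = 1 := fun t => by simp
  have hne0 : ∀ t, circleMap 0 1 t ≠ 0 := fun t => by simp
  have hneζ : ∀ t, circleMap 0 1 t ≠ ζ := fun t ht => by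
    have := hnorm t
    rw [ht] at this
    exact hζ.ne this
  have hqc : ∀ t, aeval (circleMap 0 1 t) q ≠ 0 := fun t ht => by
    have := ((hqz _ (hnorm t).le).1 ht).1
    rw [hnorm] at this
    exact lt_irrefl _ this
  have hcos : ∀ t : ℝ, (circleMap 0 1 t + (circleMap 0 1 t)⁻¹) / 2 = ((Real.cos t : ℝ) : ℂ) := by
    intro t
    rw [Complex.inv_eq_conj (hnorm t), Complex.add_conj]
    simp [circleMap, Complex.exp_ofReal_mul_I_re]
  have hFcont : Continuous F := by
    have hkc : Continuous fun t : ℝ => k (circleMap 0 1 t) :=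
      hk.continuousOn_ball.comp_continuous (continuous_circleMap 0 1) fun t => by
        simp
    have hp : ∀ p : ℝ[X], Continuous fun t : ℝ => aeval (circleMap 0 1 t) p := fun p =>
      (differentiable_aeval_complex p).continuous.comp (continuous_circleMap 0 1)
    refine (continuous_circleMap 0 1).mul (Continuous.div (((hp e).mul (hp _)).mul hkc)
      (D.continuous.comp (continuous_circleMap 0 1)) fun t => ?_)
    rw [hDev]
    exact mul_ne_zero (sub_ne_zero.2 (hneζ t)) (hqc t)
  -- in terms of `h`, the integrand has no trace of the pole `ζ`
  have hFh : ∀ t, F t = aeval (circleMap 0 1 t) e * aeval (circleMap 0 1 t) (J.secondJost N) /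
      aeval (circleMap 0 1 t) q * h (Real.cos t) := by
    intro t
    rw [← hcos, hh _ (hne0 t) (hnorm t).le (hneζ t)]
    simp only [hF, hG, hDev]
    have h1 := sub_ne_zero.2 (hneζ t)
    have h2 := hqc t
    field_simp
  -- the Wronskian relation: the parts of the density at `z` and at `z⁻¹`
  have hsym : ∀ t ∈ Set.Ioo 0 Real.pi, (2 / Real.pi * Real.sin t ^ 2 /
      (J.pC (N + 1)).eval (Real.cos t)) • h (Real.cos t) =
        ((1 / (4 * Real.pi) : ℝ) : ℂ) * (F t + F (-t)) := by
    intro t ht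
    have hz : circleMap 0 1 (-t) = (circleMap 0 1 t)⁻¹ := by
      simp [circleMap, Complex.exp_neg]
    have hq1 := hqc t
    have hq2 := hqc (-t)
    have hp := J.aeval_pC hJ (hne0 t)
    rw [hcos, aeval_ofReal_eq] at hp
    have hpos : (J.pC (N + 1)).eval (Real.cos t) ≠ 0 := by
      refine (J.pC_pos hJ ⟨?_, ?_⟩).ne'
      · rw [← Real.cos_pi]
        exact Real.strictAntiOn_cos ⟨ht.1.le, ht.2.le⟩ ⟨Real.pi_pos.le, le_rfl⟩ ht.2
      · rw [← Real.cos_zero]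
        exact Real.strictAntiOn_cos ⟨le_rfl, Real.pi_pos.le⟩ ⟨ht.1.le, ht.2.le⟩ ht.1
    have hs2 : ((circleMap 0 1 t)⁻¹ - circleMap 0 1 t) ^ 2 =
        -4 * ((Real.sin t : ℝ) : ℂ) ^ 2 := by
      have : (circleMap 0 1 t)⁻¹ - circleMap 0 1 t =
          -(2 * ((Real.sin t : ℝ) : ℂ) * Complex.I) := by
        rw [Complex.inv_eq_conj (hnorm t), ← neg_sub, Complex.sub_conj]
        simp [circleMap, Complex.exp_ofReal_mul_I_im]
      rw [this, neg_sq, mul_pow, Complex.I_sq]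
      ring
    have hw := J.jost_wronskian hJ (hne0 t)
    have hz0 := hne0 t
    have e1 := heq (circleMap 0 1 t)
    have e2 := heq (circleMap 0 1 t)⁻¹
    rw [hFh, hFh, Real.cos_neg, hz, Complex.real_smul]
    rw [hz] at hq2
    have hpC : (((J.pC (N + 1)).eval (Real.cos t) : ℝ) : ℂ) ≠ 0 := Complex.ofReal_ne_zero.2 hpos
    rw [hp] at hpC
    push_cast at hs2 ⊢
    rw [hp]
    generalize circleMap 0 1 t = z at *
    generalize aeval z (J.jost N) = c at *
    generalize aeval z⁻¹ (J.jost N) = c' at *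
    generalize aeval z (J.secondJost N) = d at *
    generalize aeval z⁻¹ (J.secondJost N) = d' at *
    generalize aeval z e = a at *
    generalize aeval z⁻¹ e = a' at *
    generalize aeval z q = b at *
    generalize aeval z⁻¹ q = b' at *
    obtain ⟨hc, hc'⟩ := mul_ne_zero_iff.1 hpC
    have e1' : a / b = (1 - z ^ 2) / c := by
      rw [div_eq_div_iff hq1 hc]
      linear_combination -e1
    have e2' : a' / b' = (1 - z⁻¹ ^ 2) / c' := by
      rw [div_eq_div_iff hq2 hc']
      linear_combination -e2
    have e3 : a * d / b + a' * d' / b' = 8 * Complex.sin t ^ 2 / (c * c') := by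
      rw [mul_div_right_comm, mul_div_right_comm, e1', e2', eq_div_iff hpC]
      have hzz : z * z⁻¹ = 1 := mul_inv_cancel₀ hz0
      have : ((1 - z ^ 2) / c * d + (1 - z⁻¹ ^ 2) / c' * d') * (c * c') =
          (1 - z ^ 2) * d * c' + (1 - z⁻¹ ^ 2) * d' * c := by
        field_simp
      rw [this]
      linear_combination -(z⁻¹ - z) * hw - 2 * hs2 - (d * c' + d' * c) * hzz
    have hpi : (Real.pi : ℂ) ≠ 0 := Complex.ofReal_ne_zero.2 Real.pi_ne_zero
    rw [← add_mul, e3]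
    field_simp
    ring
  have hFi : ∀ a b, IntervalIntegrable F volume a b := fun a b => hFcont.intervalIntegrable a b
  have hFn : Continuous fun t => F (-t) := hFcont.comp continuous_neg
  have hii : IntegrableOn (fun t => ((1 / (4 * Real.pi) : ℝ) : ℂ) * (F t + F (-t)))
      (Set.Ioo 0 Real.pi) :=
    ((continuous_const.mul (hFcont.add hFn)).integrableOn_Icc).mono_set Set.Ioo_subset_Icc_self
  refine ⟨hii.congr_fun (fun t ht => (hsym t ht).symm) measurableSet_Ioo, ?_⟩
  rw [setIntegral_congr_fun measurableSet_Ioo hsym, ← integral_Ioc_eq_integral_Ioo,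
    ← intervalIntegral.integral_of_le Real.pi_pos.le, intervalIntegral.integral_const_mul,
    intervalIntegral.integral_add (hFi _ _) (hFn.intervalIntegrable _ _),
    intervalIntegral.integral_comp_neg, neg_zero, add_comm,
    intervalIntegral.integral_add_adjacent_intervals (hFi _ _) (hFi _ _)]
  have hper : Function.Periodic F (2 * Real.pi) := fun t => by
    simp only [hF, periodic_circleMap 0 1 t]
  have h1 : ∫ t in -Real.pi..Real.pi, F t = ∫ t in (0 : ℝ)..2 * Real.pi, F t := by
    have := hper.intervalIntegral_add_eq (-Real.pi) 0
    rw [zero_add] at this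
    rw [← this]
    congr 1
    ring
  have h2 : (∮ z in C(0, 1), G z) = Complex.I * ∫ t in (0 : ℝ)..2 * Real.pi, F t := by
    rw [circleIntegral, ← intervalIntegral.integral_const_mul]
    congr 1
    ext t
    simp only [deriv_circleMap, smul_eq_mul, hF]
    ring
  rw [hres] at h2
  have h3 : ∫ t in (0 : ℝ)..2 * Real.pi, F t = 2 * Real.pi *
      ∑ w ∈ S, aeval w e * aeval w (J.secondJost N) * k w / (derivative D).eval w := by
    refine mul_left_cancel₀ Complex.I_ne_zero ?_
    rw [← h2]
    ring
  have hnot : ζ ∉ R.image fun x : ℝ => (x : ℂ) := by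
    intro h0
    obtain ⟨x, hx, h0⟩ := Finset.mem_image.1 h0
    exact (hR x hx).1 h0
  have hpi : (Real.pi : ℂ) ≠ 0 := Complex.ofReal_ne_zero.2 Real.pi_ne_zero
  rw [h1, h3, hSdef, Finset.sum_insert hnot, Finset.sum_image (by simp)]
  have h4 : ∀ x ∈ R, aeval (x : ℂ) e * aeval (x : ℂ) (J.secondJost N) * k x /
      (derivative D).eval (x : ℂ) =
        -2 * ((diracWeight (J.jost N) x : ℂ) * h ((x + (x : ℂ)⁻¹) / 2)) := by
    intro x hx
    obtain ⟨hxζ, hqx, hx1⟩ := hR x hx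
    rw [hDder, hqx, zero_add, hh _ (Complex.ofReal_ne_zero.2 (J.ne_zero_of_mem_jostRoots hx))
      hx1.le hxζ]
    rw [aeval_ofReal_eq, Complex.ofReal_eq_zero] at hqx
    obtain ⟨h5, h6⟩ := J.jost_residue hJ hq he hx hqx
    have h6' := congrArg (fun y : ℝ => (y : ℂ)) h6
    push_cast at h6'
    rw [aeval_ofReal_eq, aeval_ofReal_eq, aeval_ofReal_eq]
    have h7 := sub_ne_zero.2 hxζ
    have h8 := Complex.ofReal_ne_zero.2 h5
    rw [div_eq_iff h8] at h6'
    field_simp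
    linear_combination k x * h6'
  rw [Finset.sum_congr rfl h4, ← Finset.mul_sum, hDder, sub_self, zero_mul, add_zero]
  have h5 : aeval ζ e * aeval ζ (J.secondJost N) * k ζ / aeval ζ q =
      (1 - ζ ^ 2) * aeval ζ (J.secondJost N) * k ζ / aeval ζ (J.jost N) := by
    rw [div_eq_div_iff hqζ hcζ]
    linear_combination -aeval ζ (J.secondJost N) * k ζ * heq ζ
  rw [h5]
  push_cast
  field_simp
  ring

end JacobiData

/-! ### Uniqueness of the spectral measure -/

theorem integrable_of_continuousOn_of_ae_mem {μ : Measure ℝ} [IsFiniteMeasure μ] {r : ℝ}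
    (hμ : ∀ᵐ s ∂μ, s ∈ Set.Icc (-r) r) {f : ℝ → ℝ} (hf : ContinuousOn f (Set.Icc (-r) r)) :
    Integrable f μ := by
  have h : μ.restrict (Set.Icc (-r) r) = μ := Measure.restrict_eq_self_of_ae_mem hμ
  rw [← h]
  exact hf.integrableOn_compact isCompact_Icc

theorem continuousOn_pow_mul_inv_sub {r l : ℝ} (hl : r < l) (m : ℕ) :
    ContinuousOn (fun s : ℝ => s ^ m * (s - l)⁻¹) (Set.Icc (-r) r) :=
  (continuousOn_pow m).mul (ContinuousOn.inv₀ (by fun_prop) fun s hs => by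
    have := hs.2
    exact (by linarith : s - l < 0).ne)

/-- The `m`-th moment is read off from the Stieltjes transform of `s ^ m μ` at infinity. -/
theorem tendsto_stieltjes_moment {μ : Measure ℝ} [IsFiniteMeasure μ] {r : ℝ} (hr : 0 < r)
    (hμ : ∀ᵐ s ∂μ, s ∈ Set.Icc (-r) r) (m : ℕ) :
    Filter.Tendsto (fun l : ℝ => -l * ∫ s, s ^ m * (s - l)⁻¹ ∂μ) Filter.atTop
      (nhds (∫ s, s ^ m ∂μ)) := by
  simp only [← integral_const_mul]
  refine tendsto_integral_filter_of_dominated_convergence (fun _ => 2 * r ^ m) ?_ ?_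
    (integrable_const _) ?_
  · filter_upwards [Filter.eventually_gt_atTop r] with l hl
    exact ((integrable_of_continuousOn_of_ae_mem hμ
      (continuousOn_pow_mul_inv_sub hl m)).const_mul _).aestronglyMeasurable
  · filter_upwards [Filter.eventually_ge_atTop (2 * r)] with l hl
    filter_upwards [hμ] with s hs
    have h1 : |s| ≤ r := abs_le.2 hs
    have h2 : 0 < l - s := by linarith [hs.2]
    have h3 : |s - l| = l - s := by rw [abs_sub_comm, abs_of_pos h2]
    rw [Real.norm_eq_abs, abs_mul, abs_mul, abs_neg, abs_inv, abs_pow, h3,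
      abs_of_nonneg (by linarith : 0 ≤ l)]
    have h4 : l * (l - s)⁻¹ ≤ 2 := by
      rw [← div_eq_mul_inv, div_le_iff₀ h2]
      linarith [hs.2]
    calc l * (|s| ^ m * (l - s)⁻¹) = (l * (l - s)⁻¹) * |s| ^ m := by ring
      _ ≤ 2 * r ^ m := by gcongr
  · refine Filter.Eventually.of_forall fun s => ?_
    have h1 : Filter.Tendsto (fun l : ℝ => s ^ m * (1 - s * l⁻¹)⁻¹) Filter.atTop
        (nhds (s ^ m * (1 - s * 0)⁻¹)) :=
      ((tendsto_const_nhds.sub (tendsto_inv_atTop_zero.const_mul s)).inv₀ (by simp)).const_mul _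
    simp only [mul_zero, sub_zero, inv_one, mul_one] at h1
    refine h1.congr' ?_
    filter_upwards [Filter.eventually_gt_atTop 0, Filter.eventually_gt_atTop s] with l hl hl'
    have h2 : s - l ≠ 0 := by linarith [hl'] |> fun h : s - l < 0 => h.ne
    have h3 : l - s ≠ 0 := by rw [← neg_sub]; exact neg_ne_zero.2 h2
    have h4 : 1 - s * l⁻¹ = (l - s) / l := by field_simp
    rw [h4]
    field_simp
    ring

/-- A compactly supported measure is determined by its Stieltjes transform near infinity, which
determines the moments one after the other. -/
theorem MeasureTheory.Measure.ext_of_stieltjes {μ ν : Measure ℝ} [IsFiniteMeasure μ]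
    [IsFiniteMeasure ν]
    {r : ℝ} (hr : 0 < r) (hμ : ∀ᵐ s ∂μ, s ∈ Set.Icc (-r) r) (hν : ∀ᵐ s ∂ν, s ∈ Set.Icc (-r) r)
    (h : ∀ l : ℝ, r < l → ∫ s, (s - l)⁻¹ ∂μ = ∫ s, (s - l)⁻¹ ∂ν) : μ = ν := by
  have hA : ∀ m : ℕ, ∀ l : ℝ, r < l →
      ∫ s, s ^ m * (s - l)⁻¹ ∂μ = ∫ s, s ^ m * (s - l)⁻¹ ∂ν := by
    intro m
    induction m with
    | zero => simpa using h
    | succ m ih =>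
      have hm : ∫ s, s ^ m ∂μ = ∫ s, s ^ m ∂ν := by
        refine tendsto_nhds_unique (tendsto_stieltjes_moment hr hμ m)
          ((tendsto_stieltjes_moment hr hν m).congr' ?_)
        filter_upwards [Filter.eventually_gt_atTop r] with l hl
        rw [ih l hl]
      have hrec : ∀ (ρ : Measure ℝ) [IsFiniteMeasure ρ], (∀ᵐ s ∂ρ, s ∈ Set.Icc (-r) r) →
          ∀ l, r < l → ∫ s, s ^ (m + 1) * (s - l)⁻¹ ∂ρ =
            ∫ s, s ^ m ∂ρ + l * ∫ s, s ^ m * (s - l)⁻¹ ∂ρ := by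
        intro ρ _ hρ l hl
        rw [← integral_const_mul, ← integral_add
          (integrable_of_continuousOn_of_ae_mem hρ (continuousOn_pow m))
          ((integrable_of_continuousOn_of_ae_mem hρ
            (continuousOn_pow_mul_inv_sub hl m)).const_mul l)]
        refine integral_congr_ae ?_
        filter_upwards [hρ] with s hs
        have h2 : s - l ≠ 0 := (by linarith [hs.2] : s - l < 0).ne
        field_simp
        ring
      intro l hl
      rw [hrec μ hμ l hl, hrec ν hν l hl, hm, ih l hl]
  have hM : ∀ m : ℕ, ∫ s, s ^ m ∂μ = ∫ s, s ^ m ∂ν := by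
    intro m
    refine tendsto_nhds_unique (tendsto_stieltjes_moment hr hμ m)
      ((tendsto_stieltjes_moment hr hν m).congr' ?_)
    filter_upwards [Filter.eventually_gt_atTop r] with l hl
    rw [hA m l hl]
  have hI : ∀ (ρ : Measure ℝ) [IsFiniteMeasure ρ], (∀ᵐ s ∂ρ, s ∈ Set.Icc (-r) r) →
      ∀ p : ℝ[X], Integrable (fun s => p.eval s) ρ := fun ρ _ hρ p =>
    integrable_of_continuousOn_of_ae_mem hρ p.continuous.continuousOn
  have hP : ∀ p : ℝ[X], ∫ s, p.eval s ∂μ = ∫ s, p.eval s ∂ν := by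
    intro p
    induction p using Polynomial.induction_on' with
    | add p q hp hq =>
      simp only [eval_add]
      rw [integral_add (hI μ hμ p) (hI μ hμ q), integral_add (hI ν hν p) (hI ν hν q), hp, hq]
    | monomial n a =>
      simp only [eval_monomial]
      rw [integral_const_mul, integral_const_mul, hM]
  refine ext_of_forall_integral_eq_of_IsFiniteMeasure fun f => ?_
  have hd : ∀ ε : ℝ, 0 < ε →
      |∫ s, f s ∂μ - ∫ s, f s ∂ν| ≤ ε * (μ.real Set.univ + ν.real Set.univ) := by
    intro ε hε
    obtain ⟨p, hp⟩ :=
      exists_polynomial_near_of_continuousOn (-r) r f f.continuous.continuousOn ε hε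
    have hb : ∀ (ρ : Measure ℝ) [IsFiniteMeasure ρ], (∀ᵐ s ∂ρ, s ∈ Set.Icc (-r) r) →
        |∫ s, p.eval s ∂ρ - ∫ s, f s ∂ρ| ≤ ε * ρ.real Set.univ := by
      intro ρ _ hρ
      rw [← integral_sub (hI ρ hρ p) (f.integrable ρ), ← Real.norm_eq_abs]
      refine norm_integral_le_of_norm_le_const ?_
      filter_upwards [hρ] with s hs
      exact (hp s hs).le
    have h1 := abs_le.1 (hb μ hμ)
    have h2 := abs_le.1 (hb ν hν)
    rw [hP p] at h1
    rw [abs_le, mul_add]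
    constructor <;> linarith [h1.1, h1.2, h2.1, h2.2]
  have h0 : |∫ s, f s ∂μ - ∫ s, f s ∂ν| ≤ 0 := by
    refine ge_of_tendsto (f := fun ε : ℝ => ε * (μ.real Set.univ + ν.real Set.univ))
      (x := nhdsWithin 0 (Set.Ioi 0)) ?_ ?_
    · have : Filter.Tendsto (fun ε : ℝ => ε * (μ.real Set.univ + ν.real Set.univ)) (nhds 0)
          (nhds (0 * (μ.real Set.univ + ν.real Set.univ))) :=
        (continuous_id.mul continuous_const).tendsto 0
      rw [zero_mul] at this
      exact this.mono_left nhdsWithin_le_nhds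
    · filter_upwards [self_mem_nhdsWithin] with ε hε
      exact hd ε hε
  exact sub_eq_zero.1 (abs_nonpos_iff.1 h0)

namespace JacobiData

theorem IsSpectralMeasure.unique {J : JacobiData} {μ ν : Measure ℝ}
    (hμ : J.IsSpectralMeasure μ) (hν : J.IsSpectralMeasure ν) : μ = ν := by
  have := hμ.prob
  have := hν.prob
  obtain ⟨K, hK, hK0⟩ := hμ.compact_support
  obtain ⟨L, hL, hL0⟩ := hν.compact_support
  obtain ⟨b, hb⟩ := (hK.union hL).isBounded.exists_norm_le
  set r := max (max b 1) ‖J.op‖ with hr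
  have hr0 : 0 < r := lt_of_lt_of_le one_pos ((le_max_right b 1).trans (le_max_left _ _))
  have hsub : ∀ s ∈ K ∪ L, s ∈ Set.Icc (-r) r := fun s hs =>
    abs_le.1 ((hb s hs).trans ((le_max_left b 1).trans (le_max_left _ _)))
  refine Measure.ext_of_stieltjes hr0 ?_ ?_ fun l hl => ?_
  · rw [← mem_ae_iff] at hK0
    filter_upwards [hK0] with s hs using hsub s (Or.inl hs)
  · rw [← mem_ae_iff] at hL0
    filter_upwards [hL0] with s hs using hsub s (Or.inr hs)
  · have hl' : (l : ℂ) ∉ spectrum ℂ J.op := by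
      intro h
      have h1 := spectrum.norm_le_norm_mul_of_mem h
      have h2 : ‖(1 : EllTwo →L[ℂ] EllTwo)‖ ≤ 1 := ContinuousLinearMap.norm_id_le
      rw [Complex.norm_real, Real.norm_eq_abs, abs_of_pos (hr0.trans hl)] at h1
      have h3 : ‖J.op‖ ≤ r := le_max_right _ _
      have h4 := norm_nonneg J.op
      nlinarith
    have h1 := (hμ.stieltjes l hl').symm.trans (hν.stieltjes l hl')
    have h2 : ∀ s : ℝ, ((s : ℂ) - l)⁻¹ = (((s - l)⁻¹ : ℝ) : ℂ) := fun s => by push_cast; rfl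
    simp only [h2] at h1
    rw [integral_complex_ofReal, integral_complex_ofReal] at h1
    exact_mod_cast h1

/-! ### The spectral measure -/

/-- The measure `p_C⁻¹ μ_Δ + ∑ w δ` with one point mass for each root of the Jost function in the
unit disc. -/
noncomputable def jostMeasure (J : JacobiData) (N : ℕ) : Measure ℝ :=
  semicircle.withDensity (fun s => ENNReal.ofReal (1 / (J.pC (N + 1)).eval s)) +
    ∑ x ∈ J.jostRoots N, ENNReal.ofReal (diracWeight (J.jost N) x) • Measure.dirac (joukowski x)

theorem semicircle_withDensity (p : ℝ[X]) :
    semicircle.withDensity (fun s => ENNReal.ofReal (1 / p.eval s)) =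
      (volume.restrict (Set.Ioo (-1) 1)).withDensity fun s =>
        ((2 / Real.pi * Real.sqrt (1 - s ^ 2) * (1 / p.eval s)).toNNReal : ℝ≥0∞) := by
  have hm : Measurable fun s : ℝ => p.eval s := p.continuous.measurable
  rw [semicircle, Measure.restrict_congr_set Ioo_ae_eq_Icc.symm,
    ← withDensity_mul _ (by fun_prop) (by fun_prop)]
  congr 1
  ext s
  rw [Pi.mul_apply, ← ENNReal.ofReal_mul (by positivity)]
  rfl

/-- The substitution `s = cos t` in integrals against the absolutely continuous part. -/
theorem integral_semicircle_withDensity (J : JacobiData) {N : ℕ}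
    (hJ : J.EqFreeOutside (N + 1)) {h : ℝ → ℂ}
    (hi : IntegrableOn (fun t : ℝ => (2 / Real.pi * Real.sin t ^ 2 /
      (J.pC (N + 1)).eval (Real.cos t)) • h (Real.cos t)) (Set.Ioo 0 Real.pi)) :
    Integrable h (semicircle.withDensity
      fun s => ENNReal.ofReal (1 / (J.pC (N + 1)).eval s)) ∧
    ∫ s, h s ∂(semicircle.withDensity
      fun s => ENNReal.ofReal (1 / (J.pC (N + 1)).eval s)) =
      ∫ t in Set.Ioo 0 Real.pi, (2 / Real.pi * Real.sin t ^ 2 /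
        (J.pC (N + 1)).eval (Real.cos t)) • h (Real.cos t) := by
  set p := J.pC (N + 1)
  have himg : Real.cos '' Set.Ioo 0 Real.pi = Set.Ioo (-1) 1 := by
    ext s
    constructor
    · rintro ⟨t, ht, rfl⟩
      constructor
      · rw [← Real.cos_pi]
        exact Real.strictAntiOn_cos ⟨ht.1.le, ht.2.le⟩ ⟨Real.pi_pos.le, le_rfl⟩ ht.2
      · rw [← Real.cos_zero]
        exact Real.strictAntiOn_cos ⟨le_rfl, Real.pi_pos.le⟩ ⟨ht.1.le, ht.2.le⟩ ht.1
    · intro hs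
      exact ⟨Real.arccos s, ⟨Real.arccos_pos.2 hs.2, Real.arccos_lt_pi.2 hs.1⟩,
        Real.cos_arccos hs.1.le hs.2.le⟩
  have hder : ∀ t ∈ Set.Ioo 0 Real.pi,
      HasDerivWithinAt Real.cos (-Real.sin t) (Set.Ioo 0 Real.pi) t := fun t _ =>
    (Real.hasDerivAt_cos t).hasDerivWithinAt
  have hinj : Set.InjOn Real.cos (Set.Ioo 0 Real.pi) :=
    Real.injOn_cos.mono Set.Ioo_subset_Icc_self
  set φ : ℝ → NNReal := fun s => (2 / Real.pi * Real.sqrt (1 - s ^ 2) * (1 / p.eval s)).toNNReal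
    with hφ
  have hφm : Measurable φ := by fun_prop
  have hcongr : ∀ t ∈ Set.Ioo 0 Real.pi, |-Real.sin t| • (φ (Real.cos t) • h (Real.cos t)) =
      (2 / Real.pi * Real.sin t ^ 2 / p.eval (Real.cos t)) • h (Real.cos t) := by
    intro t ht
    have hs := Real.sin_pos_of_mem_Ioo ht
    have hp : 0 < p.eval (Real.cos t) := J.pC_pos hJ (himg ▸ Set.mem_image_of_mem _ ht)
    have hsq : Real.sqrt (1 - Real.cos t ^ 2) = Real.sin t := by
      rw [← Real.sin_sq, Real.sqrt_sq hs.le]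
    simp only [hφ]
    rw [NNReal.smul_def, smul_smul, abs_neg, abs_of_pos hs, hsq,
      Real.coe_toNNReal _ (by positivity)]
    congr 1
    ring
  rw [semicircle_withDensity]
  constructor
  · rw [integrable_withDensity_iff_integrable_smul hφm]
    change IntegrableOn (fun s => φ s • h s) (Set.Ioo (-1) 1)
    rw [← himg, integrableOn_image_iff_integrableOn_abs_deriv_smul measurableSet_Ioo hder hinj]
    exact hi.congr_fun (fun t ht => (hcongr t ht).symm) measurableSet_Ioo
  · rw [integral_withDensity_eq_integral_smul hφm, ← himg,
      integral_image_eq_integral_abs_deriv_smul measurableSet_Ioo hder hinj]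
    exact setIntegral_congr_fun measurableSet_Ioo hcongr

theorem diracWeight_pos (J : JacobiData) {N : ℕ} (hJ : J.EqFreeOutside (N + 1)) {x : ℝ}
    (hx : x ∈ J.jostRoots N) : 0 < diracWeight (J.jost N) x := by
  obtain ⟨hc, hx1⟩ := J.mem_jostRoots.1 hx
  have hx0 := J.ne_zero_of_mem_jostRoots hx
  refine div_pos (sq_pos_of_ne_zero fun h => ?_) (J.jost_weight_pos hJ hx1 hc)
  have h1 : x ^ 2 = 1 := by
    field_simp at h
    linear_combination h
  exact ((sq_lt_one_iff_abs_lt_one x).2 hx1).ne h1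

/-- Integrals against the candidate measure of functions with a single pole in the disc. -/
theorem integral_jostMeasure (J : JacobiData) {N : ℕ} (hJ : J.EqFreeOutside (N + 1)) {ζ : ℂ}
    (hζ : ‖ζ‖ < 1) (hcζ : aeval ζ (J.jost N) ≠ 0) {k h : ℂ → ℂ}
    (hk : DiffContOnCl ℂ k (Metric.ball 0 1))
    (hh : ∀ z, z ≠ 0 → ‖z‖ ≤ 1 → z ≠ ζ → h ((z + z⁻¹) / 2) = z * k z / (z - ζ)) :
    Integrable (fun s : ℝ => h s) (J.jostMeasure N) ∧
    ∫ s : ℝ, h s ∂(J.jostMeasure N) =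
      (1 - ζ ^ 2) * aeval ζ (J.secondJost N) * k ζ / (2 * aeval ζ (J.jost N)) := by
  obtain ⟨h1, h2⟩ := J.integral_density hJ hζ hcζ hk hh
  obtain ⟨h3, h4⟩ := J.integral_semicircle_withDensity hJ (h := fun s : ℝ => h s) h1
  have h5 : ∀ x ∈ J.jostRoots N, Integrable (fun s : ℝ => h s)
      (ENNReal.ofReal (diracWeight (J.jost N) x) • Measure.dirac (joukowski x)) := fun x _ =>
    (integrable_dirac (by simp)).smul_measure ENNReal.ofReal_ne_top
  refine ⟨h3.add_measure (integrable_finsetSum_measure.2 h5), ?_⟩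
  rw [jostMeasure, integral_add_measure h3 (integrable_finsetSum_measure.2 h5), h4, h2,
    integral_finsetSum_measure h5, sub_add_eq_add_sub, sub_eq_iff_eq_add]
  congr 1
  refine Finset.sum_congr rfl fun x hx => ?_
  rw [integral_smul_measure, integral_dirac,
    ENNReal.toReal_ofReal (J.diracWeight_pos hJ hx).le, Complex.real_smul, joukowski]
  push_cast
  rfl

theorem isSpectralMeasure_jostMeasure (J : JacobiData) {N : ℕ}
    (hJ : J.EqFreeOutside (N + 1)) : J.IsSpectralMeasure (J.jostMeasure N) where
  prob := by
    have h0 : aeval (0 : ℂ) (J.jost N) ≠ 0 := fun h => J.ne_zero_of_aeval_jost h rfl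
    -- the total mass is the case of the constant function, with the pole at the origin
    obtain ⟨h1, h2⟩ := J.integral_jostMeasure hJ (ζ := 0) (by simp) h0 (k := fun _ => 1)
      (h := fun _ => 1) diffContOnCl_const (fun z hz _ _ => by field_simp; simp)
    have hfin : IsFiniteMeasure (J.jostMeasure N) :=
      (integrable_const_iff.1 h1).resolve_left one_ne_zero
    have hd : aeval (0 : ℂ) (J.secondJost N) = 2 * aeval (0 : ℂ) (J.jost N) := by
      have := J.eval_zero_secondJost N
      rw [← Complex.ofReal_zero, aeval_ofReal_eq, aeval_ofReal_eq, this]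
      push_cast
      rfl
    have h3 : (J.jostMeasure N).real Set.univ = 1 := by
      rw [hd, integral_const] at h2
      have : (((J.jostMeasure N).real Set.univ : ℝ) : ℂ) = 1 := by
        rw [Complex.real_smul, mul_one] at h2
        rw [h2]
        field_simp
        simp
      exact_mod_cast this
    refine ⟨?_⟩
    rw [← ENNReal.toReal_eq_one_iff]
    exact h3
  compact_support := by
    refine ⟨Set.Icc (-1) 1 ∪ joukowski '' (J.jostRoots N), isCompact_Icc.union
      ((Finset.finite_toSet _).image _).isCompact, ?_⟩
    rw [jostMeasure, Measure.add_apply, Measure.finsetSum_apply, semicircle]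
    rw [add_eq_zero]
    constructor
    · refine (withDensity_absolutelyContinuous _ _) ((withDensity_absolutelyContinuous _ _) ?_)
      rw [Measure.restrict_apply' measurableSet_Icc]
      convert measure_empty (μ := (volume : Measure ℝ))
      ext s
      simp only [Set.mem_inter_iff, Set.mem_compl_iff, Set.mem_union]
      tauto
    · refine Finset.sum_eq_zero fun x hx => ?_
      rw [Measure.smul_apply, Measure.dirac_apply]
      simp only [Set.compl_union]
      rw [Set.indicator_of_notMem, smul_zero]
      exact fun h => h.2 ⟨x, hx, rfl⟩
  stieltjes := by
    intro l hl
    obtain ⟨ζ, hζ0, hζ, rfl, hc, hG⟩ := J.principalResolvent_eq hJ hl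
    have hk0 : ∀ z : ℂ, ‖z‖ ≤ 1 → z * ζ - 1 ≠ 0 := by
      intro z hz h
      have h1 : ‖z * ζ‖ = 1 := by rw [sub_eq_zero.1 h, norm_one]
      rw [norm_mul] at h1
      have := norm_nonneg ζ
      nlinarith
    have hk : DiffContOnCl ℂ (fun z : ℂ => 2 * ζ / (z * ζ - 1)) (Metric.ball 0 1) := by
      have h1 : DiffContOnCl ℂ (fun z : ℂ => (z * ζ - 1)⁻¹) (Metric.ball 0 1) := by
        refine DiffContOnCl.inv (Differentiable.diffContOnCl (by fun_prop)) fun z hz => ?_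
        rw [closure_ball _ one_ne_zero, mem_closedBall_zero_iff] at hz
        exact hk0 z hz
      simp only [div_eq_mul_inv]
      exact h1.const_smul (2 * ζ)
    obtain ⟨-, h2⟩ := J.integral_jostMeasure hJ hζ hc hk
      (h := fun s => (s - (ζ + ζ⁻¹) / 2)⁻¹) (fun z hz hz1 hzζ => by
        have h1 := hk0 z hz1
        have h2 := sub_ne_zero.2 hzζ
        have h3 : (z + z⁻¹) / 2 - (ζ + ζ⁻¹) / 2 = (z - ζ) * (z * ζ - 1) / (2 * z * ζ) := by
          field_simp
          ring
        rw [h3]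
        field_simp)
    rw [hG, h2]
    have h1 : ζ ^ 2 - 1 ≠ 0 := by
      have := hk0 ζ hζ.le
      rwa [← sq] at this
    rw [← sq]
    field_simp
    ring

end JacobiData

theorem theorem4p12 (J : JacobiData) (n : ℕ) (hn : 1 ≤ n) (hJ : J.EqFreeOutside n) :
    -- `C_{J→Δ}` has a Toeplitz part, of bandwidth at most `2n-1`
    (∃ c : ℝ[X], c.natDegree ≤ 2 * n - 1 ∧ IsToeplitzSymbol (J.connection JacobiData.free) c) ∧
    ∀ c : ℝ[X], IsToeplitzSymbol (J.connection JacobiData.free) c →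
      -- the roots of `c` on the unit circle can only be `±1`, and they are simple
      (∀ z : ℂ, ‖z‖ = 1 → aeval z c = 0 → (z = 1 ∨ z = -1) ∧ aeval z (derivative c) ≠ 0) ∧
      -- the roots of `c` in the open unit disc are real, simple, and at most `n` in number
      ∃ (r : ℕ) (z : Fin r → ℝ), r ≤ n ∧ Function.Injective z ∧
        (∀ w : ℂ, ‖w‖ < 1 ∧ aeval w c = 0 ↔ ∃ k, w = (z k : ℂ)) ∧
        (∀ k, (derivative c).eval (z k) ≠ 0) ∧
        -- the density `1 / p_C` and the weights are positive, so `ENNReal.ofReal` below is harmless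
        (∀ s ∈ Set.Ioo (-1 : ℝ) 1, 0 < (J.pC n).eval s) ∧
        (∀ k, 0 < diracWeight c (z k)) ∧
        -- the formula for the spectral measure
        ∀ μ : Measure ℝ, J.IsSpectralMeasure μ ↔
          μ = semicircle.withDensity (fun s => ENNReal.ofReal (1 / (J.pC n).eval s)) +
            ∑ k, ENNReal.ofReal (diracWeight c (z k)) • Measure.dirac (joukowski (z k)) := by
  obtain ⟨N, rfl⟩ : ∃ N, n = N + 1 := ⟨n - 1, by omega⟩
  refine ⟨⟨J.jost N, (J.natDegree_jost_le hJ).trans (by omega), J.isToeplitzSymbol_jost hJ⟩,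
    fun c hc => ?_⟩
  obtain rfl := hc.unique (J.isToeplitzSymbol_jost hJ)
  refine ⟨fun z hz h => ⟨J.jost_root_of_norm_eq_one hJ hz h,
    J.derivative_jost_ne_zero_of_norm_eq_one hJ hz h⟩, ?_⟩
  have hz : ∀ k : Fin (J.jostRoots N).card, ((J.jostRoots N).equivFin.symm k : ℝ) ∈ J.jostRoots N :=
    fun k => ((J.jostRoots N).equivFin.symm k).2
  have hsum : ∑ k : Fin (J.jostRoots N).card,
      ENNReal.ofReal (diracWeight (J.jost N) ((J.jostRoots N).equivFin.symm k)) •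
        Measure.dirac (joukowski ((J.jostRoots N).equivFin.symm k)) =
      ∑ x ∈ J.jostRoots N,
        ENNReal.ofReal (diracWeight (J.jost N) x) • Measure.dirac (joukowski x) := by
    rw [← Finset.sum_coe_sort (J.jostRoots N)]
    exact Equiv.sum_comp (J.jostRoots N).equivFin.symm fun x : J.jostRoots N =>
      ENNReal.ofReal (diracWeight (J.jost N) x) • Measure.dirac (joukowski x)
  refine ⟨(J.jostRoots N).card, fun k => ((J.jostRoots N).equivFin.symm k : ℝ),
    J.card_jostRoots_le hJ,
    Subtype.val_injective.comp (Equiv.injective _), fun w => ?_, fun k h => ?_,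
    fun s hs => J.pC_pos hJ hs, fun k => J.diracWeight_pos hJ (hz k), fun μ => ?_⟩
  · rw [J.aeval_jost_eq_zero_iff hJ]
    constructor
    · rintro ⟨x, hx, rfl⟩
      exact ⟨(J.jostRoots N).equivFin ⟨x, hx⟩, by simp⟩
    · rintro ⟨k, rfl⟩
      exact ⟨_, hz k, rfl⟩
  · obtain ⟨h0, h1⟩ := J.mem_jostRoots.1 (hz k)
    have := J.jost_weight_pos hJ h1 h0
    simp [h] at this
  · rw [hsum]
    exact ⟨fun h => h.unique (J.isSpectralMeasure_jostMeasure hJ),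
      fun h => h ▸ J.isSpectralMeasure_jostMeasure hJ⟩
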